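/- Let $N,k,l\in\mathbb{N}=\{0,1,2,\dots\}$, $\mathbb{R}_+=(0,\infty)$, and for $u\in\mathbb{R}^N$ let $\Delta_N(u)=\prod_{1\le i<j\le N}(u_j-u_i)$. Let $\alpha:\mathbb{R}\to\mathbb{C}$ be a function, let $\lambda=(\lambda_1,\dots,\lambda_l)$ be pairwise distinct complex numbers, and let $\kappa=(\kappa_1,\dots,\kappa_k)$ be pairwise distinct elements of $\mathbb{C}\setminus[0,\infty)$. Assume that $\alpha$ is suitably integrable in the sense that $$\int_0^\infty z^{n}\,\left|\alpha(z)\,\frac{\prod_{i=1}^l(z-\lambda_i)}{\prod_{i=1}^k(z-\kappa_i)}\right|dz<\infty\qquad (n=0,1,\dots,N-1)$$ (the functions $z\mapsto z^n\alpha(z)\prod_{i=1}^l(z-\lambda_i)/\prod_{i=1}^k(z-\kappa_i)$ being measurable). Define the partition function of the Bures-like ensemble $$Z^{(N,\mathrm B)}_{k|l}[\alpha](\kappa,\lambda)=\frac1{N!}\int_{\mathbb{R}_+^N}\frac{\Delta_N^2(z)}{\prod_{1\le i<j\le N}(z_i+z_j)}\prod_{j=1}^N\alpha(z_j)\frac{\prod_{i=1}^l(z_j-\lambda_i)}{\prod_{i=1}^k(z_j-\kappa_i)}\,d[z]$$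 and the partition function of the Cauchy-like two-matrix ensemble, with weights $\alpha(x)$ and $\alpha(y)y$, $$Z^{(N,\mathrm C)}_{k|l;k|l}[\alpha](\kappa,\lambda;\kappa,\lambda)=\frac1{(N!)^2}\int_{\mathbb{R}_+^{2N}}\frac{\Delta_N^2(x)\,\Delta_N^2(y)}{\prod_{i,j=1}^N(x_i+y_j)}\prod_{j=1}^N\left(\alpha(x_j)\,\alpha(y_j)\,y_j\,\frac{\prod_{i=1}^l(x_j-\lambda_i)(y_j-\lambda_i)}{\prod_{i=1}^k(x_j-\kappa_i)(y_j-\kappa_i)}\right)d[x]\,d[y].$$ Then both integrals converge absolutely, and $$\left(Z^{(N,\mathrm B)}_{k|l}[\alpha](\kappa,\lambda)\right)^2=2^N\,Z^{(N,\mathrm C)}_{k|l;k|l}[\alpha](\kappa,\lambda;\kappa,\lambda).$$ -/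

import Mathlib

open MeasureTheory

noncomputable section

/-- The Vandermonde determinant `Δ_N(u) = det [u_a ^ (b-1)] = ∏_{i<j} (u_j - u_i)`. -/
def vandermondeDet {N : ℕ} (u : Fin N → ℝ) : ℝ := (Matrix.vandermonde u).det

/-- The open positive orthant `ℝ₊^N`, the domain of integration. -/
def positiveOrthant (N : ℕ) : Set (Fin N → ℝ) := {z | ∀ j, 0 < z j}

/-- The one-point factor `∏_{i=1}^l (z - lam_i) / ∏_{i=1}^k (z - κ_i)`. -/
def charRatio {k l : ℕ} (κ : Fin k → ℂ) (lam : Fin l → ℂ) (z : ℝ) : ℂ :=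
  (∏ i, ((z : ℂ) - lam i)) / ∏ i, ((z : ℂ) - κ i)

/-- The integrand of the partition function of the Bures-like ensemble. -/
def buresIntegrand {N k l : ℕ} (α : ℝ → ℂ) (κ : Fin k → ℂ) (lam : Fin l → ℂ)
    (z : Fin N → ℝ) : ℂ :=
  ((vandermondeDet z ^ 2 / ∏ i, ∏ j ∈ Finset.Ioi i, (z i + z j) : ℝ) : ℂ) *
    ∏ j, (α (z j) * charRatio κ lam (z j))

/-- The partition function `Z^{(N,B)}_{k|l}[α](κ, lam)` of the Bures-like ensemble. -/
def buresPartition (N : ℕ) {k l : ℕ} (α : ℝ → ℂ) (κ : Fin k → ℂ) (lam : Fin l → ℂ) : ℂ :=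
  1 / (N.factorial : ℂ) * ∫ z in positiveOrthant N, buresIntegrand α κ lam z

/-- The integrand of the partition function of the Cauchy-like two-matrix ensemble; the one-point
weights are `α(x)` for the first and `α(y) y` for the second set of variables. -/
def cauchyIntegrand {N k₁ l₁ k₂ l₂ : ℕ} (α : ℝ → ℂ)
    (κ₁ : Fin k₁ → ℂ) (lam₁ : Fin l₁ → ℂ) (κ₂ : Fin k₂ → ℂ) (lam₂ : Fin l₂ → ℂ)
    (p : (Fin N → ℝ) × (Fin N → ℝ)) : ℂ :=
  ((vandermondeDet p.1 ^ 2 * vandermondeDet p.2 ^ 2 /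
      ∏ i, ∏ j, (p.1 i + p.2 j) : ℝ) : ℂ) *
    ∏ j, (α (p.1 j) * (α (p.2 j) * (p.2 j : ℂ)) *
      (charRatio κ₁ lam₁ (p.1 j) * charRatio κ₂ lam₂ (p.2 j)))

/-- The partition function `Z^{(N,C)}_{k₁|l₁;k₂|l₂}[α](κ₁, lam₁; κ₂, lam₂)` of the Cauchy-like
two-matrix ensemble. -/
def cauchyPartition (N : ℕ) {k₁ l₁ k₂ l₂ : ℕ} (α : ℝ → ℂ)
    (κ₁ : Fin k₁ → ℂ) (lam₁ : Fin l₁ → ℂ) (κ₂ : Fin k₂ → ℂ) (lam₂ : Fin l₂ → ℂ) : ℂ :=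
  1 / (N.factorial : ℂ) ^ 2 *
    ∫ p in positiveOrthant N ×ˢ positiveOrthant N, cauchyIntegrand α κ₁ lam₁ κ₂ lam₂ p

/-- Suitable integrability of the one-point weight `α` for given `N`, `κ` and `lam`: the moments of
order `0, …, N - 1` of the weight `α(z) ∏ (z - lam_i) / ∏ (z - κ_i)` on `ℝ₊` converge
absolutely. -/
def SuitableWeight (N : ℕ) {k l : ℕ} (α : ℝ → ℂ) (κ : Fin k → ℂ) (lam : Fin l → ℂ) : Prop :=
  ∀ n < N, IntegrableOn (fun z : ℝ => (z : ℂ) ^ n * (α z * charRatio κ lam z)) (Set.Ioi 0)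

end

open MeasureTheory

/-! Both sides reduce to one determinant of bimoments. Let `w` be the full one-point weight, φ_i(z)
= z^i w(z), and m_i = ∫ φ_i. The Bures integrand is Schur's product ∏_{i<j} (z_j - z_i)/(z_i + z_j)
times det[φ_i(z_j)]. By Schur's Pfaffian that product is, up to normalisation and sign, the Pfaffian
of (x - y)/(x + y), bordered by ones for odd N (`exists_pfSum_schurKernel_eq`). De Bruijn's formula
(`integral_pfSum_mul_alternant`) then integrates it to a Pfaffian of the bimoments A_ij of that
kernel, bordered by the m_i.

The square of such a Pfaffian is, for either parity, a multiple of det[m_i m_j - A_ij] (`pfSum_sq`).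
Since 1 - (x - y)/(x + y) = 2y/(x + y), this matrix is 2C, with C the bimoment matrix of y/(x + y)
(`moment_mul_moment_sub_bimoment`); hence the factor 2^N. The Cauchy determinant and Andréief's
identity (`integral_kernelDet_mul_alternant_mul_alternant`) turn the two-matrix integral into (N!)²
det C.

The Pfaffian is kept as an unnormalised sum over all permutations. `pfSum_sq` is used twice,
pointwise to prove Schur's formula and again for the bimoments, so the normalising constant cancels.
Both kernels are bounded by one on the positive quadrant, so integrability of the φ_i suffices
throughout. -/

/-! ### The Cauchy determinant -/

theorem prod_erase_eq_prod_Ioi_mul_prod_Ioi {K : Type*} [CommMonoid K] {N : ℕ}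
    (f : Fin N → Fin N → K) :
    ∏ j, ∏ k ∈ Finset.univ.erase j, f j k =
      (∏ i, ∏ j ∈ Finset.Ioi i, f j i) * ∏ i, ∏ j ∈ Finset.Ioi i, f i j := by
  have h1 : ∏ i : Fin N, ∏ j ∈ Finset.Ioi i, f j i = ∏ j : Fin N, ∏ i ∈ Finset.Iio j, f j i :=
    Finset.prod_comm' (by simp)
  rw [h1, ← Finset.prod_mul_distrib]
  refine Finset.prod_congr rfl fun j _ => ?_
  rw [← Finset.prod_union]
  · refine Finset.prod_congr ?_ fun _ _ => rfl
    ext k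
    simp [lt_or_lt_iff_ne]
  · rw [Finset.disjoint_left]
    intro k hk hk'
    simp only [Finset.mem_Iio, Finset.mem_Ioi] at hk hk'
    exact lt_asymm hk hk'

/-- The Cauchy determinant. -/
theorem det_inv_add_mul_prod {K : Type*} [Field K] {N : ℕ} (x y : Fin N → K)
    (h : ∀ i j, x i + y j ≠ 0) :
    (Matrix.of fun i j => (x i + y j)⁻¹).det * ∏ i, ∏ j, (x i + y j) =
      (Matrix.vandermonde x).det * (Matrix.vandermonde y).det := by
  classical
  by_cases hy : Function.Injective y
  swap
  · rw [Function.not_injective_iff] at hy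
    obtain ⟨a, b, hab, hne⟩ := hy
    rw [Matrix.det_zero_of_column_eq hne (fun k => by simp [hab]),
      Matrix.det_vandermonde_eq_zero_iff.2 ⟨a, b, hab, hne⟩]
    simp
  -- Multiplying row i by ∏_k (x_i + y_k) clears denominators and leaves the entries P_j(x_i). As
  -- deg P_j < N, this matrix is the Vandermonde matrix of x times the coefficient matrix `C`, which
  -- does not depend on x.
  set P : Fin N → Polynomial K := fun j =>
    ∏ k ∈ Finset.univ.erase j, (Polynomial.X + Polynomial.C (y k)) with hP
  have hdeg : ∀ j, (P j).natDegree < N := by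
    intro j
    rw [hP, Polynomial.natDegree_prod_of_monic _ _ (fun k _ => Polynomial.monic_X_add_C _)]
    simp
    have := j.2
    omega
  set C : Matrix (Fin N) (Fin N) K := Matrix.of fun k j => (P j).coeff k with hC
  have hev : ∀ u : Fin N → K,
      (Matrix.of fun i j => (P j).eval (u i)) = Matrix.vandermonde u * C := by
    intro u
    ext i j
    simp only [Matrix.of_apply, Matrix.mul_apply, Matrix.vandermonde_apply, hC]
    rw [Polynomial.eval_eq_sum_range' (hdeg j), Finset.sum_range]
    exact Finset.sum_congr rfl fun k _ => mul_comm _ _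
  have hPe : ∀ j t, (P j).eval t = ∏ k ∈ Finset.univ.erase j, (t + y k) := by
    intro j t
    simp [hP, Polynomial.eval_prod]
  have h1 : (Matrix.of fun i j => (x i + y j)⁻¹).det * ∏ i, ∏ j, (x i + y j) =
      (Matrix.vandermonde x).det * C.det := by
    rw [← Matrix.det_mul, ← hev, mul_comm, ← Matrix.det_mul_column]
    congr 1
    ext i j
    simp only [Matrix.of_apply, hPe]
    rw [← Finset.mul_prod_erase Finset.univ _ (Finset.mem_univ j), mul_comm, ← mul_assoc,
      inv_mul_cancel₀ (h i j), one_mul]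
  have hV : (Matrix.vandermonde fun i => - y i).det ≠ 0 := by
    rw [Ne, Matrix.det_vandermonde_eq_zero_iff]
    rintro ⟨i, j, hij, hne⟩
    exact hne (hy (neg_injective hij))
  -- det C is found by evaluating at x = -y, where P_j(-y_i) vanishes off the diagonal; injectivity
  -- of y allows the Vandermonde factor to be cancelled.
  have h2 : (Matrix.vandermonde fun i => - y i).det * C.det =
      (Matrix.vandermonde fun i => - y i).det * (Matrix.vandermonde y).det := by
    rw [← Matrix.det_mul, ← hev]
    have : (Matrix.of fun i j => (P j).eval (- y i)) =
        Matrix.diagonal fun j => ∏ k ∈ Finset.univ.erase j, (y k - y j) := by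
      ext i j
      rw [Matrix.of_apply, hPe, Matrix.diagonal_apply]
      split_ifs with hij
      · subst hij
        exact Finset.prod_congr rfl fun k _ => by ring
      · exact Finset.prod_eq_zero (Finset.mem_erase.2 ⟨hij, Finset.mem_univ i⟩) (by ring)
    rw [this, Matrix.det_diagonal, prod_erase_eq_prod_Ioi_mul_prod_Ioi, Matrix.det_vandermonde,
      Matrix.det_vandermonde]
    congr 1
    exact Finset.prod_congr rfl fun i _ => Finset.prod_congr rfl fun j _ => by ring
  rw [h1, mul_left_cancel₀ hV h2]

/-! ### Unnormalised Pfaffians as alternating forms -/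

/-- The matching product `∏ a (z (i,0)) (z (i,1)) ∏ m (z e)`. -/
def pfTerm {n : ℕ} {E X K : Type*} [Fintype E] [CommRing K] (a : X → X → K) (m : X → K)
    (z : (Fin n × Fin 2) ⊕ E → X) : K :=
  (∏ i, a (z (Sum.inl (i, 0))) (z (Sum.inl (i, 1)))) * ∏ e, m (z (Sum.inr e))

/-- The unnormalised Pfaffian: the antisymmetrisation of `pfTerm`. -/
def pfSum {n : ℕ} {E X K : Type*} [Fintype E] [DecidableEq E] [CommRing K] (a : X → X → K)
    (m : X → K) (z : (Fin n × Fin 2) ⊕ E → X) : K :=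
  ∑ σ : Equiv.Perm ((Fin n × Fin 2) ⊕ E), Equiv.Perm.sign σ • pfTerm a m (fun i => z (σ i))

section Algebra

variable {n : ℕ} {E V K : Type*} [Fintype E] [DecidableEq E] [Field K] [AddCommGroup V]
  [Module K V]

/-- Each index occurs in exactly one factor of the matching product, and that factor is linear in
it. -/
theorem exists_linear_pfTerm_update (ω : V →ₗ[K] V →ₗ[K] K) (m : V →ₗ[K] K)
    (v : (Fin n × Fin 2) ⊕ E → V) (j : (Fin n × Fin 2) ⊕ E) :
    ∃ L : V →ₗ[K] K, ∀ x,
      pfTerm (fun x y => ω x y) (fun x => m x) (Function.update v j x) = L x := by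
  rcases j with ⟨i, b⟩ | e
  · set R : K := (∏ k ∈ Finset.univ.erase i, ω (v (Sum.inl (k, 0))) (v (Sum.inl (k, 1)))) *
      ∏ e, m (v (Sum.inr e)) with hR
    have key : ∀ x, pfTerm (fun x y => ω x y) (fun x => m x)
        (Function.update v (Sum.inl (i, b)) x) =
        ω (Function.update v (Sum.inl (i, b)) x (Sum.inl (i, 0)))
          (Function.update v (Sum.inl (i, b)) x (Sum.inl (i, 1))) * R := by
      intro x
      rw [pfTerm, ← Finset.mul_prod_erase Finset.univ _ (Finset.mem_univ i), mul_assoc, hR]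
      congr 2
      refine Finset.prod_congr rfl fun k hk => ?_
      have hk' := Finset.ne_of_mem_erase hk
      rw [Function.update_of_ne (by simp [hk']), Function.update_of_ne (by simp [hk'])]
    fin_cases b
    · refine ⟨R • ω.flip (v (Sum.inl (i, 1))), fun x => ?_⟩
      rw [key]
      simp [mul_comm]
    · refine ⟨R • ω (v (Sum.inl (i, 0))), fun x => ?_⟩
      rw [key]
      simp [mul_comm]
  · refine ⟨((∏ i, ω (v (Sum.inl (i, 0))) (v (Sum.inl (i, 1)))) *
      ∏ k ∈ Finset.univ.erase e, m (v (Sum.inr k))) • m, fun x => ?_⟩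
    rw [pfTerm, ← Finset.mul_prod_erase Finset.univ _ (Finset.mem_univ e)]
    have : ∏ k ∈ Finset.univ.erase e, m (Function.update v (Sum.inr e) x (Sum.inr k)) =
        ∏ k ∈ Finset.univ.erase e, m (v (Sum.inr k)) := by
      refine Finset.prod_congr rfl fun k hk => ?_
      rw [Function.update_of_ne (by simp [Finset.ne_of_mem_erase hk])]
    rw [this, Function.update_self]
    simp only [ne_eq, reduceCtorEq, not_false_eq_true, Function.update_of_ne,
      LinearMap.smul_apply, smul_eq_mul]
    ring

/-- `pfTerm` of a bilinear form and a linear form, as a multilinear map. -/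
def pfMultilinear (n : ℕ) (E : Type*) [Fintype E] [DecidableEq E] (ω : V →ₗ[K] V →ₗ[K] K)
    (m : V →ₗ[K] K) : MultilinearMap K (fun _ : (Fin n × Fin 2) ⊕ E => V) K where
  toFun := pfTerm (fun x y => ω x y) (fun x => m x)
  map_update_add' := by
    intro inst v j x y
    obtain ⟨L, hL⟩ := exists_linear_pfTerm_update ω m v j
    have h : inst = (fun a b => instDecidableEqSum a b) := Subsingleton.elim _ _
    subst h
    rw [hL, hL, hL, map_add]
  map_update_smul' := by
    intro inst v j c x
    obtain ⟨L, hL⟩ := exists_linear_pfTerm_update ω m v j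
    have h : inst = (fun a b => instDecidableEqSum a b) := Subsingleton.elim _ _
    subst h
    rw [hL, hL, map_smul]

theorem alternatization_pfMultilinear_apply (ω : V →ₗ[K] V →ₗ[K] K) (m : V →ₗ[K] K)
    (v : (Fin n × Fin 2) ⊕ E → V) :
    (pfMultilinear n E ω m).alternatization v = pfSum (fun x y => ω x y) (fun x => m x) v := by
  rw [MultilinearMap.alternatization_apply]
  rfl

/-- Alternating forms of top degree are multiples of the determinant. With `det_gram_basis_change`,
this lets the square formula be checked on a single convenient basis. -/
theorem pfSum_basis_change (ω : V →ₗ[K] V →ₗ[K] K) (m : V →ₗ[K] K)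
    (b : Module.Basis ((Fin n × Fin 2) ⊕ E) K V) (v : (Fin n × Fin 2) ⊕ E → V) :
    pfSum (fun x y => ω x y) (fun x => m x) v =
      pfSum (fun x y => ω x y) (fun x => m x) b * b.det v := by
  rw [← alternatization_pfMultilinear_apply, ← alternatization_pfMultilinear_apply]
  conv_lhs => rw [AlternatingMap.eq_smul_basis_det b (pfMultilinear n E ω m).alternatization]
  simp

theorem det_gram_basis_change {ι : Type*} [Fintype ι] [DecidableEq ι] (M : V →ₗ[K] V →ₗ[K] K)
    (b c : Module.Basis ι K V) :
    (Matrix.of fun i j => M (c i) (c j)).det =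
      b.det c ^ 2 * (Matrix.of fun i j => M (b i) (b j)).det := by
  have h := LinearMap.BilinForm.toMatrix_mul_basis_toMatrix b c M
  have e : ∀ d : Module.Basis ι K V,
      (Matrix.of fun i j => M (d i) (d j)) = LinearMap.BilinForm.toMatrix d M := by
    intro d
    ext i j
    simp [LinearMap.BilinForm.toMatrix_apply]
  rw [e, e, ← h, Matrix.det_mul, Matrix.det_mul, Matrix.det_transpose, Module.Basis.det_apply]
  ring

theorem linearIndependent_of_det_gram_ne_zero {ι : Type*} [Fintype ι] [DecidableEq ι]
    (M : V →ₗ[K] V →ₗ[K] K) (v : ι → V) (h : (Matrix.of fun i j => M (v i) (v j)).det ≠ 0) :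
    LinearIndependent K v := by
  rw [Fintype.linearIndependent_iff]
  intro g hg
  have : Matrix.vecMul g (Matrix.of fun i j => M (v i) (v j)) = 0 := by
    ext j
    have := congrArg (fun x => M x (v j)) hg
    simpa [Matrix.vecMul, dotProduct] using this
  exact fun i => congrFun (Matrix.eq_zero_of_vecMul_eq_zero h this) i

/-! ### Symplectic bases -/

/-- The Gram matrix of a symplectic basis. -/
def symplecticGram (K : Type*) [Field K] (n : ℕ) : Matrix (Fin n × Fin 2) (Fin n × Fin 2) K :=
  Matrix.kronecker 1 !![0, 1; -1, 0]

theorem symplecticGram_apply (p q : Fin n × Fin 2) :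
    symplecticGram K n p q = if p.1 = q.1 then !![0, 1; -1, 0] p.2 q.2 else 0 := by
  simp [symplecticGram, Matrix.kroneckerMap_apply, Matrix.one_apply]

theorem det_symplecticGram : (symplecticGram K n).det = 1 := by
  rw [symplecticGram]
  erw [Matrix.det_kronecker]
  simp [Matrix.det_fin_two]

/-- Symplectic Gram–Schmidt: split off a hyperbolic plane spanned by `u`, `w`, and recurse on its
orthogonal complement in `W`, which is again nondegenerate. The bound `d` serves only as the
induction variable. -/
theorem exists_symplectic_family [FiniteDimensional K V] (ω : V →ₗ[K] V →ₗ[K] K)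
    (hω : ∀ x, ω x x = 0) (d : ℕ) : ∀ W : Submodule K V, Module.finrank K W ≤ d →
    (∀ w ∈ W, (∀ w' ∈ W, ω w w' = 0) → w = 0) →
    ∃ (n : ℕ) (v : Fin n × Fin 2 → V), (∀ p, v p ∈ W) ∧
      W ≤ Submodule.span K (Set.range v) ∧ ∀ p q, ω (v p) (v q) = symplecticGram K n p q := by
  have hanti : ∀ x y, ω x y = - ω y x := by
    intro x y
    have h := hω (x + y)
    simp only [map_add, LinearMap.add_apply, hω] at h
    linear_combination h
  induction d with
  | zero =>
    intro W hW _
    have : W = ⊥ := Submodule.finrank_eq_zero.1 (by omega)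
    subst this
    exact ⟨0, fun p => p.1.elim0, fun p => p.1.elim0, bot_le, fun p => p.1.elim0⟩
  | succ d ih =>
    intro W hW hnd
    by_cases hbot : W = ⊥
    · subst hbot
      exact ⟨0, fun p => p.1.elim0, fun p => p.1.elim0, bot_le, fun p => p.1.elim0⟩
    obtain ⟨u, huW, hu⟩ := Submodule.exists_mem_ne_zero_of_ne_bot hbot
    obtain ⟨w₀, hw₀W, hw₀⟩ : ∃ w ∈ W, ω u w ≠ 0 := by
      by_contra! hcon
      exact hu (hnd u huW hcon)
    set w := (ω u w₀)⁻¹ • w₀ with hw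
    have hwW : w ∈ W := W.smul_mem _ hw₀W
    have huw : ω u w = 1 := by simp [hw, hw₀]
    have hwu : ω w u = -1 := by rw [hanti, huw]
    set W' : Submodule K V := W ⊓ (LinearMap.ker (ω u) ⊓ LinearMap.ker (ω w)) with hW'
    have memW' : ∀ y, y ∈ W' ↔ y ∈ W ∧ ω u y = 0 ∧ ω w y = 0 := by
      intro y; simp [hW']
    have hlt : W' < W := by
      refine lt_of_le_of_ne inf_le_left fun hEq => ?_
      have : w ∈ W' := hEq ▸ hwW
      rw [memW', huw] at this
      exact one_ne_zero this.2.1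
    -- Projection along the hyperbolic plane; it gives both the nondegeneracy of `W'` and the
    -- spanning property.
    have hdec : ∀ y ∈ W, y - (- ω w y) • u - (ω u y) • w ∈ W' := by
      intro y hy
      rw [memW']
      refine ⟨W.sub_mem (W.sub_mem hy (W.smul_mem _ huW)) (W.smul_mem _ hwW), ?_, ?_⟩
      · simp [hω, huw]
      · simp [hω, hwu]
    obtain ⟨n, v, hvW, hspan, hgram⟩ := ih W'
      (by have := Submodule.finrank_lt_finrank_of_lt hlt; omega) (by
        intro x hx hx'
        have hx2 := (memW' x).1 hx
        refine hnd x hx2.1 fun y hy => ?_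
        have h := hx' _ (hdec y hy)
        have h1 : ω x u = 0 := by rw [hanti, hx2.2.1, neg_zero]
        have h2 : ω x w = 0 := by rw [hanti, hx2.2.2, neg_zero]
        simpa [h1, h2] using h)
    have hv2 := fun p => (memW' _).1 (hvW p)
    refine ⟨n + 1, fun p => Fin.cases (![u, w] p.2) (fun i => v (i, p.2)) p.1, ?_, ?_, ?_⟩
    · rintro ⟨i, b⟩
      refine Fin.cases ?_ (fun i => ?_) i
      · fin_cases b
        · exact huW
        · exact hwW
      · exact (hv2 _).1
    · intro y hy
      have h1 := hspan (hdec y hy)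
      have hle : Submodule.span K (Set.range v) ≤ Submodule.span K (Set.range
          (fun p : Fin (n + 1) × Fin 2 =>
            (Fin.cases (![u, w] p.2) (fun i => v (i, p.2)) p.1 : V))) := by
        refine Submodule.span_mono ?_
        rintro _ ⟨⟨i, b⟩, rfl⟩
        exact ⟨(i.succ, b), rfl⟩
      have h2 := hle h1
      have hu' := Submodule.subset_span (R := K) (Set.mem_range_self
        (f := fun p : Fin (n + 1) × Fin 2 =>
          (Fin.cases (![u, w] p.2) (fun i => v (i, p.2)) p.1 : V)) (0, 0))
      have hw' := Submodule.subset_span (R := K) (Set.mem_range_self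
        (f := fun p : Fin (n + 1) × Fin 2 =>
          (Fin.cases (![u, w] p.2) (fun i => v (i, p.2)) p.1 : V)) (0, 1))
      have h3 := Submodule.add_mem _ (Submodule.add_mem _ h2 (Submodule.smul_mem _ (ω u y) hw'))
        (Submodule.smul_mem _ (- ω w y) hu')
      convert h3 using 1
      simp
    · rintro ⟨i, b⟩ ⟨j, c⟩
      have h1 : ∀ p, ω (v p) u = 0 := fun p => by rw [hanti, (hv2 p).2.1, neg_zero]
      have h2 : ∀ p, ω (v p) w = 0 := fun p => by rw [hanti, (hv2 p).2.2, neg_zero]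
      refine Fin.cases ?_ (fun i => ?_) i <;> refine Fin.cases ?_ (fun j => ?_) j
      · fin_cases b <;> fin_cases c <;> simp [symplecticGram_apply, hω, huw, hwu]
      · fin_cases b <;> simp [symplecticGram_apply, hv2, (Fin.succ_ne_zero j).symm]
      · fin_cases c <;> simp [symplecticGram_apply, h1, h2]
      · simp [symplecticGram_apply, hgram]

end Algebra

/-! ### The normalising constant -/

section Constant

variable {n : ℕ} {E K : Type*} [Fintype E] [DecidableEq E] [Field K]

/-- The standard alternating form on the index type of `pfSum`. -/
def stdForm (n : ℕ) (E K : Type*) [Field K] :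
    (Fin n × Fin 2) ⊕ E → (Fin n × Fin 2) ⊕ E → K
  | Sum.inl p, Sum.inl q => symplecticGram K n p q
  | _, _ => 0

/-- The standard linear form on the index type of `pfSum`. -/
def stdLin (n : ℕ) (E K : Type*) [Field K] : (Fin n × Fin 2) ⊕ E → K :=
  Sum.elim (fun _ => 0) (fun _ => 1)

/-- A nonzero product forces τ to map pairs to pairs, so τ is a permutation π of the pairs composed
with swaps s_i inside them. π acts on both layers and contributes sign(π)² = 1, while the i-th
factor of the product is sign(s_i), cancelling the rest. -/
theorem sign_mul_prod_symplecticGram (τ : Equiv.Perm (Fin n × Fin 2))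
    (h : ∏ i, symplecticGram K n (τ (i, 0)) (τ (i, 1)) ≠ 0) :
    Equiv.Perm.sign τ • ∏ i, symplecticGram K n (τ (i, 0)) (τ (i, 1)) = 1 := by
  have h' : ∀ i, symplecticGram K n (τ (i, 0)) (τ (i, 1)) ≠ 0 := fun i =>
    Finset.prod_ne_zero_iff.1 h i (Finset.mem_univ i)
  have hfst : ∀ i, (τ (i, 1)).1 = (τ (i, 0)).1 := by
    intro i
    by_contra hne
    exact h' i (by rw [symplecticGram_apply, if_neg (Ne.symm hne)])
  have hinj : Function.Injective fun i => (τ (i, 0)).1 := by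
    intro i j hij
    have hij' : (τ (i, 0)).1 = (τ (j, 0)).1 := hij
    -- If two pairs met the same block, three distinct elements would lie in `Fin 2`.
    by_contra hne
    have h0 : ∀ b c, τ (i, b) ≠ τ (j, c) := fun b c hbc => hne (by
      have := τ.injective hbc
      exact congrArg Prod.fst this)
    have h1 := h' i
    rw [symplecticGram_apply, if_pos (hfst i).symm] at h1
    have h2 : (τ (i, 0)).2 ≠ (τ (j, 0)).2 := fun hh => h0 0 0 (Prod.ext hij' hh)
    have h3 : (τ (i, 1)).2 ≠ (τ (j, 0)).2 := fun hh =>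
      h0 1 0 (Prod.ext ((hfst i).trans hij') hh)
    have h4 : (τ (i, 0)).2 ≠ (τ (i, 1)).2 := by
      intro hh
      apply h1
      rw [hh]
      generalize (τ (i, 1)).2 = b
      fin_cases b <;> rfl
    generalize (τ (i, 0)).2 = a at *
    generalize (τ (i, 1)).2 = b at *
    generalize (τ (j, 0)).2 = c at *
    omega
  set π : Equiv.Perm (Fin n) := Equiv.ofBijective _ (Finite.injective_iff_bijective.1 hinj) with hπ
  set s : Fin n → Equiv.Perm (Fin 2) := fun i =>
    if (τ (i, 0)).2 = 0 then 1 else Equiv.swap 0 1 with hs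
  have hb : ∀ i, ((τ (i, 0)).2 = 0 ∧ (τ (i, 1)).2 = 1) ∨
      ((τ (i, 0)).2 = 1 ∧ (τ (i, 1)).2 = 0) := by
    intro i
    have h1 := h' i
    rw [symplecticGram_apply, if_pos (hfst i).symm] at h1
    generalize (τ (i, 0)).2 = a at *
    generalize (τ (i, 1)).2 = b at *
    fin_cases a <;> fin_cases b <;> simp at h1 ⊢
  have hτ : τ = Equiv.prodCongrLeft (fun _ : Fin 2 => π) * Equiv.prodCongrRight s := by
    ext1 ⟨i, b⟩
    have e : (Equiv.prodCongrLeft (fun _ : Fin 2 => π) * Equiv.prodCongrRight s) (i, b) =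
        (π i, s i b) := rfl
    have hπi : π i = (τ (i, 0)).1 := rfl
    rw [e, hπi]
    rcases hb i with ⟨h0, h1⟩ | ⟨h0, h1⟩
    · have : s i = 1 := by simp [hs, h0]
      fin_cases b
      · exact Prod.ext rfl (by simp [this, h0])
      · exact Prod.ext (hfst i) (by simp [this, h1])
    · have : s i = Equiv.swap 0 1 := by simp [hs, h0]
      fin_cases b
      · exact Prod.ext rfl (by simp [this, h0])
      · exact Prod.ext (hfst i) (by simp [this, h1])
  have hsign : Equiv.Perm.sign τ = ∏ i, Equiv.Perm.sign (s i) := by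
    conv_lhs => rw [hτ]
    rw [Equiv.Perm.sign_mul, Equiv.Perm.sign_prodCongrLeft, Equiv.Perm.sign_prodCongrRight]
    simp
  have hterm : ∀ i, symplecticGram K n (τ (i, 0)) (τ (i, 1)) =
      ((Equiv.Perm.sign (s i) : ℤ) : K) := by
    intro i
    rw [symplecticGram_apply, if_pos (hfst i).symm]
    rcases hb i with ⟨h0, h1⟩ | ⟨h0, h1⟩
    · simp [hs, h0, h1]
    · simp [hs, h0, h1]
  rw [hsign, Finset.prod_congr rfl fun i _ => hterm i, Units.smul_def, zsmul_eq_mul,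
    Units.coe_prod, Int.cast_prod, ← Finset.prod_mul_distrib]
  refine Finset.prod_eq_one fun i _ => ?_
  rw [← Int.cast_mul, ← Units.val_mul, Int.units_mul_self]
  simp

theorem sign_smul_pfTerm_std [Subsingleton E] (σ : Equiv.Perm ((Fin n × Fin 2) ⊕ E))
    (h : pfTerm (stdForm n E K) (stdLin n E K) (fun i => σ i) ≠ 0) :
    Equiv.Perm.sign σ • pfTerm (stdForm n E K) (stdLin n E K) (fun i => σ i) = 1 := by
  have h' : ∀ i, stdForm n E K (σ (Sum.inl (i, 0))) (σ (Sum.inl (i, 1))) ≠ 0 := fun i =>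
    Finset.prod_ne_zero_iff.1 (left_ne_zero_of_mul h) i (Finset.mem_univ i)
  have hmaps : Set.MapsTo σ (Set.range Sum.inl) (Set.range Sum.inl) := by
    rintro _ ⟨⟨i, b⟩, rfl⟩
    have := h' i
    rcases h0 : σ (Sum.inl (i, 0)) with p | e <;> rcases h1 : σ (Sum.inl (i, 1)) with q | e' <;>
      rw [h0, h1] at this <;> simp only [stdForm, ne_eq, not_true_eq_false] at this
    fin_cases b
    · exact ⟨p, h0.symm⟩
    · exact ⟨q, h1.symm⟩
  obtain ⟨⟨τ, ρ⟩, rfl⟩ := Equiv.Perm.mem_sumCongrHom_range_of_perm_mapsTo_inl hmaps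
  have hρ : ρ = 1 := Subsingleton.elim _ _
  subst hρ
  simp only [pfTerm, Equiv.Perm.sumCongrHom_apply, Equiv.sumCongr_apply, Sum.map_inl, Sum.map_inr,
    Equiv.Perm.sign_sumCongr, Equiv.Perm.sign_one, mul_one, stdForm, stdLin, Sum.elim_inr,
    Finset.prod_const_one] at h ⊢
  exact sign_mul_prod_symplecticGram τ h

/-- Every nonzero signed term equals 1, so the sum counts such permutations, the identity among
them; this is where characteristic zero enters. -/
theorem pfSum_std_ne_zero [Subsingleton E] [CharZero K] :
    pfSum (stdForm n E K) (stdLin n E K) id ≠ 0 := by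
  classical
  have h : pfSum (stdForm n E K) (stdLin n E K) id =
      ∑ σ : Equiv.Perm ((Fin n × Fin 2) ⊕ E),
        if pfTerm (stdForm n E K) (stdLin n E K) (fun i => σ i) ≠ 0 then 1 else 0 := by
    refine Finset.sum_congr rfl fun σ _ => ?_
    split_ifs with hσ
    · exact sign_smul_pfTerm_std σ hσ
    · simp only [id]
      rw [not_not.1 hσ, smul_zero]
  rw [h, Finset.sum_boole, Nat.cast_ne_zero]
  refine Finset.card_ne_zero.2 ⟨1, ?_⟩
  simp [pfTerm, stdForm, stdLin, symplecticGram_apply]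

end Constant

/-! ### The square of a bordered Pfaffian -/

section Square

variable {n : ℕ} {E V K : Type*} [Fintype E] [DecidableEq E] [Field K] [AddCommGroup V]
  [Module K V]

/-- By the matrix determinant lemma, with J the symplectic matrix and (-J)⁻¹ = J, the determinant is
det(-J)(1 + mᵀJm), and mᵀJm = 0. The linear form is thus invisible when ω is nondegenerate. -/
theorem det_vecMulVec_sub_symplecticGram (m : Fin n × Fin 2 → K) :
    (Matrix.of fun p q => m p * m q - symplecticGram K n p q).det = 1 := by
  have hsq : (-symplecticGram K n) * symplecticGram K n = 1 := by
    rw [Matrix.neg_mul, symplecticGram]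
    erw [← Matrix.mul_kronecker_mul]
    ext p q
    rw [Matrix.neg_apply]
    erw [Matrix.kroneckerMap_apply]
    obtain ⟨i, b⟩ := p
    obtain ⟨j, c⟩ := q
    fin_cases b <;> fin_cases c <;> simp [Matrix.one_apply, Matrix.mul_apply, Fin.sum_univ_two]
  have hdet : (-symplecticGram K n).det = 1 := by
    rw [Matrix.det_neg, det_symplecticGram]
    simp [mul_comm n 2, pow_mul]
  have hinv : (-symplecticGram K n)⁻¹ = symplecticGram K n := Matrix.inv_eq_right_inv hsq
  have h := Matrix.det_add_replicateCol_mul_replicateRow (ι := Unit)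
    (A := -symplecticGram K n) (by rw [hdet]; exact isUnit_one) m m
  have h1 : (Matrix.of fun p q => m p * m q - symplecticGram K n p q) =
      -symplecticGram K n + Matrix.replicateCol Unit m * Matrix.replicateRow Unit m := by
    ext p q
    simp [Matrix.mul_apply]
    ring
  have h2 : Matrix.replicateRow Unit m * symplecticGram K n * Matrix.replicateCol Unit m = 0 := by
    ext i j
    simp only [Matrix.mul_apply, Matrix.replicateRow_apply, Matrix.replicateCol_apply,
      symplecticGram_apply, Fintype.sum_prod_type, Fin.sum_univ_two, Matrix.zero_apply,
      mul_ite, mul_zero, Finset.sum_ite_eq', Finset.sum_add_distrib]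
    simp [mul_comm]
  rw [h1, h, hinv, h2, hdet]
  simp

theorem exists_symplectic_family_of_finrank [FiniteDimensional K V] (ω : V →ₗ[K] V →ₗ[K] K)
    (hω : ∀ x, ω x x = 0) (W : Submodule K V)
    (hnd : ∀ w ∈ W, (∀ w' ∈ W, ω w w' = 0) → w = 0) :
    ∃ (n : ℕ) (v : Fin n × Fin 2 → V), Module.finrank K W = 2 * n ∧ (∀ p, v p ∈ W) ∧
      ∀ p q, ω (v p) (v q) = symplecticGram K n p q := by
  obtain ⟨n, v, hv, hspan, hgram⟩ := exists_symplectic_family ω hω _ W le_rfl hnd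
  refine ⟨n, v, ?_, hv, hgram⟩
  have hW : W = Submodule.span K (Set.range v) := by
    refine le_antisymm hspan (Submodule.span_le.2 ?_)
    rintro _ ⟨p, rfl⟩
    exact hv p
  have hli : LinearIndependent K v := by
    refine linearIndependent_of_det_gram_ne_zero ω v ?_
    have : (Matrix.of fun i j => ω (v i) (v j)) = symplecticGram K n := by
      ext i j
      exact hgram i j
    rw [this, det_symplecticGram]
    exact one_ne_zero
  rw [hW, finrank_span_eq_card hli]
  simp [mul_comm]

theorem pfSum_eq_zero_of_radical (ω : V →ₗ[K] V →ₗ[K] K) (hω : ∀ x, ω x x = 0) (m : V →ₗ[K] K)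
    (v : (Fin n × Fin 2) ⊕ E → V) (k : (Fin n × Fin 2) ⊕ E) (hm : m (v k) = 0)
    (hk : ω (v k) = 0) :
    pfSum (fun x y => ω x y) (fun x => m x) v = 0 := by
  have hk' : ∀ x, ω x (v k) = 0 := by
    intro x
    have h := hω (x + v k)
    simpa [hω, hk] using h
  refine Finset.sum_eq_zero fun σ _ => ?_
  have : pfTerm (fun x y => ω x y) (fun x => m x) (fun i => v (σ i)) = 0 := by
    obtain ⟨j, rfl⟩ := σ.surjective k
    rcases j with ⟨i, b⟩ | e
    · refine mul_eq_zero_of_left (Finset.prod_eq_zero (Finset.mem_univ i) ?_) _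
      fin_cases b
      · exact congrFun (congrArg DFunLike.coe hk) _
      · exact hk' _
    · exact mul_eq_zero_of_right _ (Finset.prod_eq_zero (Finset.mem_univ e) hm)
  rw [this, smul_zero]

/-- Both sides scale by the squared determinant under a change of basis. If M = m ⊗ m - ω is
degenerate, both vanish. Otherwise a basis with standard Pfaffian and Gram determinant 1 exists: a
symplectic basis of V if ω is nondegenerate (`E` empty), or a symplectic basis of ker m completed by
a vector of the radical of ω (`E` a point). -/
theorem pfSum_sq_basis [Subsingleton E] (ω : V →ₗ[K] V →ₗ[K] K)
    (hω : ∀ x, ω x x = 0) (m : V →ₗ[K] K) (b : Module.Basis ((Fin n × Fin 2) ⊕ E) K V) :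
    pfSum (fun x y => ω x y) (fun x => m x) b ^ 2 =
      pfSum (stdForm n E K) (stdLin n E K) id ^ 2 *
        (Matrix.of fun i j => m (b i) * m (b j) - ω (b i) (b j)).det := by
  have hfd : FiniteDimensional K V := b.finiteDimensional_of_finite
  have hrank : Module.finrank K V = 2 * n + Fintype.card E := by
    rw [Module.finrank_eq_card_basis b]
    simp [mul_comm]
  set M : V →ₗ[K] V →ₗ[K] K := m.smulRight m - ω with hM
  have hMa : ∀ x y, M x y = m x * m y - ω x y := fun x y => by simp [hM]
  have hrad : ∀ u, M u = 0 → m u = 0 ∧ ω u = 0 := by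
    intro u hu
    have h1 : M u u = 0 := by rw [hu]; rfl
    rw [hMa, hω, sub_zero, mul_self_eq_zero] at h1
    refine ⟨h1, LinearMap.ext fun y => ?_⟩
    have h2 : M u y = 0 := by rw [hu]; rfl
    rw [hMa, h1, zero_mul, zero_sub, neg_eq_zero] at h2
    exact h2
  have hG : ∀ c : (Fin n × Fin 2) ⊕ E → V,
      (Matrix.of fun i j => m (c i) * m (c j) - ω (c i) (c j)) =
      Matrix.of fun i j => M (c i) (c j) := fun c => by
    ext i j
    exact (hMa _ _).symm
  have hvm : ∀ (g : (Fin n × Fin 2) ⊕ E → K) j,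
      Matrix.vecMul g (Matrix.of fun i j => M (b i) (b j)) j = M (∑ i, g i • b i) (b j) := by
    intro g j
    simp [Matrix.vecMul, dotProduct]
  rw [hG]
  by_cases hD : (Matrix.of fun i j => M (b i) (b j)).det = 0
  · obtain ⟨g, hg, hgM⟩ := Matrix.exists_vecMul_eq_zero_iff.2 hD
    obtain ⟨k, hk⟩ := Function.ne_iff.1 hg
    set u := ∑ i, g i • b i with hu
    have hMu : M u = 0 := b.ext fun j => by
      rw [← hvm, hgM]
      rfl
    obtain ⟨h1, h2⟩ := hrad u hMu
    have h3 := pfSum_eq_zero_of_radical ω hω m (Function.update b k u) k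
      (by rw [Function.update_self, h1]) (by rw [Function.update_self, h2])
    -- Replacing `b k` by the radical vector `u` multiplies the Pfaffian by the coordinate g k ≠ 0
    -- and makes it zero.
    rw [pfSum_basis_change ω m b, Module.Basis.det_apply, Module.Basis.toMatrix_update,
      Module.Basis.toMatrix_self, ← Matrix.cramer_apply, Matrix.cramer_one] at h3
    have h4 : b.repr u = Finsupp.equivFunOnFinite.symm g := by
      ext i
      exact congrFun (b.repr_sum_self g) i
    rw [h4] at h3
    have h5 : pfSum (fun x y => ω x y) (fun x => m x) b = 0 :=
      (mul_eq_zero.1 h3).resolve_right hk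
    rw [h5, hD]
    simp
  have hnd : ∀ u, M u = 0 → u = 0 := by
    intro u hu
    have : Matrix.vecMul (b.repr u) (Matrix.of fun i j => M (b i) (b j)) = 0 := by
      ext j
      rw [hvm, b.sum_repr, hu]
      rfl
    have h := Matrix.eq_zero_of_vecMul_eq_zero hD this
    rw [← b.sum_repr u]
    simp [h]
  have hker : ∀ u, u ≠ 0 → ω u = 0 →
      ∃ v : Fin n × Fin 2 → V, Module.finrank K V = 2 * n + 1 ∧ (∀ p, m (v p) = 0) ∧
        ∀ p q, ω (v p) (v q) = symplecticGram K n p q := by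
    intro u hu hωu
    have hmu : m u ≠ 0 := by
      intro hmu
      refine hu (hnd u (LinearMap.ext fun y => ?_))
      rw [hMa, hmu, hωu]
      simp
    obtain ⟨n', v, hr, hvW, hgram⟩ := exists_symplectic_family_of_finrank ω hω (LinearMap.ker m) (by
      intro w hw hw'
      refine hnd w (LinearMap.ext fun y => ?_)
      have hwu : ω w u = 0 := by
        have h := hω (w + u)
        simpa [hω, hωu] using h
      -- Subtracting a multiple of `u` moves y into ker m without changing ω w y, so ω is
      -- nondegenerate on ker m.
      have h := hw' (y - (m y * (m u)⁻¹) • u) (by simp [hmu])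
      rw [LinearMap.mem_ker] at hw
      rw [map_sub, map_smul, hwu, smul_zero, sub_zero] at h
      rw [hMa, hw, h]
      simp)
    have hrn := LinearMap.finrank_range_add_finrank_ker m
    have hsurj : LinearMap.range m = ⊤ := by
      rw [LinearMap.range_eq_top]
      exact LinearMap.surjective fun h => hmu (by rw [h]; rfl)
    rw [hsurj, finrank_top, Module.finrank_self, hr, hrank] at hrn
    have hle : Fintype.card E ≤ 1 := Fintype.card_le_one_iff_subsingleton.2 inferInstance
    -- Parity: 2n' + 1 = 2n + |E| with |E| ≤ 1.
    obtain rfl : n' = n := by omega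
    exact ⟨v, by omega, hvW, hgram⟩
  have hexists : ∃ c : (Fin n × Fin 2) ⊕ E → V,
      pfSum (fun x y => ω x y) (fun x => m x) c = pfSum (stdForm n E K) (stdLin n E K) id ∧
      (Matrix.of fun i j => M (c i) (c j)).det = 1 := by
    have hnondeg : (∀ u, ω u = 0 → u = 0) → ∃ v : Fin n × Fin 2 → V, IsEmpty E ∧
        ∀ p q, ω (v p) (v q) = symplecticGram K n p q := by
      intro h
      obtain ⟨n', v, hr, -, hgram⟩ := exists_symplectic_family_of_finrank ω hω ⊤
        fun w _ hw => h w (LinearMap.ext fun y => hw y trivial)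
      rw [finrank_top, hrank] at hr
      have hle : Fintype.card E ≤ 1 := Fintype.card_le_one_iff_subsingleton.2 inferInstance
      obtain rfl : n' = n := by omega
      exact ⟨v, Fintype.card_eq_zero_iff.1 (by omega), hgram⟩
    by_cases hω0 : ∀ u, ω u = 0 → u = 0
    · obtain ⟨v, hE, hgram⟩ := hnondeg hω0
      refine ⟨Sum.elim v (fun e => hE.elim e), ?_, ?_⟩
      · refine Finset.sum_congr rfl fun σ _ => ?_
        congr 1
        simp only [pfTerm, Finset.univ_eq_empty, Finset.prod_empty, mul_one]
        refine Finset.prod_congr rfl fun i _ => ?_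
        rcases h0 : σ (Sum.inl (i, 0)) with p | e
        · rcases h1 : σ (Sum.inl (i, 1)) with q | e
          · simp [stdForm, hgram]
          · exact hE.elim e
        · exact hE.elim e
      · have h1 := det_vecMulVec_sub_symplecticGram (fun p => m (v p))
        rw [← Matrix.det_submatrix_equiv_self (Equiv.sumEmpty (Fin n × Fin 2) E).symm, ← h1]
        congr 1
        ext p q
        simp [hMa, hgram]
    · push Not at hω0
      obtain ⟨u, hωu, hu⟩ := hω0
      obtain ⟨v, hr, hmv, hgram⟩ := hker u hu hωu
      have hmu : m u ≠ 0 := by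
        intro hmu
        refine hu (hnd u (LinearMap.ext fun y => ?_))
        rw [hMa, hmu, hωu]
        simp
      have hu' : ∀ w, ω w u = 0 := fun w => by
        have h := hω (w + u)
        simpa [hω, hωu] using h
      refine ⟨Sum.elim v (fun _ => (m u)⁻¹ • u), ?_, ?_⟩
      · refine Finset.sum_congr rfl fun σ _ => ?_
        have e1 : ∀ i j, ω (Sum.elim v (fun _ => (m u)⁻¹ • u) i)
            (Sum.elim v (fun _ => (m u)⁻¹ • u) j) = stdForm n E K i j := by
          rintro (p | e) (q | e') <;> simp [stdForm, hgram, hωu, hu']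
        have e2 : ∀ i, m (Sum.elim v (fun _ => (m u)⁻¹ • u) i) = stdLin n E K i := by
          rintro (p | e) <;> simp [stdLin, hmv, hmu]
        simp only [pfTerm, e1, e2, id]
      · have : (Matrix.of fun i j => M (Sum.elim v (fun _ : E => (m u)⁻¹ • u) i)
            (Sum.elim v (fun _ : E => (m u)⁻¹ • u) j)) =
            Matrix.fromBlocks (-symplecticGram K n) 0 0 1 := by
          ext (p | e) (q | e')
          · simp [hMa, hmv, hgram]
          · simp [hMa, hmv, hu']
          · simp [hMa, hmv, hωu]
          · simp [hMa, hmu, hωu, Subsingleton.elim e e']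
        rw [this, Matrix.det_fromBlocks_zero₂₁, Matrix.det_one, mul_one]
        have h1 := det_vecMulVec_sub_symplecticGram (fun _ : Fin n × Fin 2 => (0 : K))
        rw [← h1]
        congr 1
        ext p q
        simp
  obtain ⟨c, hc1, hc2⟩ := hexists
  have hli := linearIndependent_of_det_gram_ne_zero M c (by rw [hc2]; exact one_ne_zero)
  obtain ⟨c', rfl⟩ : ∃ c' : Module.Basis ((Fin n × Fin 2) ⊕ E) K V, ⇑c' = c :=
    ⟨basisOfLinearIndependentOfCardEqFinrank' c hli (Module.finrank_eq_card_basis b).symm,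
      coe_basisOfLinearIndependentOfCardEqFinrank' c hli _⟩
  rw [← hc1, pfSum_basis_change ω m b c']
  rw [det_gram_basis_change M b c'] at hc2
  linear_combination (-pfSum (fun x y => ω x y) (fun x => m x) b ^ 2) * hc2

/-- The square of the Pfaffian of an antisymmetric `a`, in determinantal form. -/
theorem pfSum_sq [CharZero K] [Subsingleton E] {X : Type*} (a : X → X → K)
    (ha : ∀ x y, a x y = - a y x) (m : X → K) (z : (Fin n × Fin 2) ⊕ E → X) :
    pfSum a m z ^ 2 = pfSum (stdForm n E K) (stdLin n E K) id ^ 2 *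
      (Matrix.of fun i j => m (z i) * m (z j) - a (z i) (z j)).det := by
  have hself : ∀ x, a x x = 0 := fun x => self_eq_neg.1 (ha x x)
  set A : Matrix ((Fin n × Fin 2) ⊕ E) ((Fin n × Fin 2) ⊕ E) K :=
    Matrix.of fun i j => a (z i) (z j) with hA
  set ω := Matrix.toBilin' A with hωd
  set b := Pi.basisFun K ((Fin n × Fin 2) ⊕ E) with hb
  set l : ((Fin n × Fin 2) ⊕ E → K) →ₗ[K] K := b.constr K (fun i => m (z i)) with hl
  have h1 : ∀ i j, ω (b i) (b j) = a (z i) (z j) := by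
    intro i j
    simp [hωd, hb, hA, Matrix.toBilin'_single]
  have h2 : ∀ i, l (b i) = m (z i) := fun i => by rw [hl, Module.Basis.constr_basis]
  have halt : ∀ x, ω x x = 0 := by
    intro x
    have h : ω x x = - ω x x := by
      conv_lhs => rw [hωd, Matrix.toBilin'_apply, Finset.sum_comm]
      conv_rhs => rw [hωd, Matrix.toBilin'_apply, ← Finset.sum_neg_distrib]
      refine Finset.sum_congr rfl fun i _ => ?_
      rw [← Finset.sum_neg_distrib]
      refine Finset.sum_congr rfl fun j _ => ?_
      simp only [hA, Matrix.of_apply]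
      rw [ha]
      ring
    exact self_eq_neg.1 h
  have h := pfSum_sq_basis ω halt l b
  simp only [h1, h2] at h
  rw [← h]
  simp only [pfSum, pfTerm, h1, h2]

end Square

/-! ### Schur's Pfaffian -/

section Schur

variable {n N : ℕ} {E : Type*} [Fintype E] [DecidableEq E]

theorem pfSum_comp_perm {X K : Type*} [CommRing K] (a : X → X → K) (m : X → K)
    (z : (Fin n × Fin 2) ⊕ E → X) (τ : Equiv.Perm ((Fin n × Fin 2) ⊕ E)) :
    pfSum a m (fun i => z (τ i)) = Equiv.Perm.sign τ • pfSum a m z := by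
  rw [pfSum, pfSum, Finset.smul_sum]
  refine Fintype.sum_equiv (Equiv.mulLeft τ) _ _ fun σ => ?_
  rw [Equiv.coe_mulLeft, Equiv.Perm.sign_mul, smul_smul, ← mul_assoc, Int.units_mul_self, one_mul]
  rfl

/-- The product `∏_{i<j} (z i + z j)`. -/
def pairSumProd (z : Fin N → ℝ) : ℝ := ∏ i, ∏ j ∈ Finset.Ioi i, (z i + z j)

/-- Schur's product `∏_{i<j} (z j - z i) / (z i + z j)`. -/
noncomputable def schurProd (z : Fin N → ℝ) : ℝ := vandermondeDet z / pairSumProd z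

/-- Schur's antisymmetric kernel `(x - y) / (x + y)`. -/
noncomputable def schurKernel (x y : ℝ) : ℂ := (((x - y) / (x + y) : ℝ) : ℂ)

theorem schurKernel_antisymm (x y : ℝ) : schurKernel x y = - schurKernel y x := by
  rw [schurKernel, schurKernel, ← Complex.ofReal_neg, ← neg_div, neg_sub, add_comm]

theorem pairSumProd_pos {z : Fin N → ℝ} (hz : ∀ i, 0 < z i) : 0 < pairSumProd z :=
  Finset.prod_pos fun i _ => Finset.prod_pos fun j _ => add_pos (hz i) (hz j)

theorem prod_prod_add_eq (z : Fin N → ℝ) :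
    ∏ i, ∏ j, (z i + z j) = (∏ i, 2 * z i) * pairSumProd z ^ 2 := by
  have h : ∀ i, ∏ j, (z i + z j) = 2 * z i * ∏ j ∈ Finset.univ.erase i, (z i + z j) := by
    intro i
    rw [← Finset.mul_prod_erase Finset.univ _ (Finset.mem_univ i), two_mul]
  rw [Finset.prod_congr rfl fun i _ => h i, Finset.prod_mul_distrib,
    prod_erase_eq_prod_Ioi_mul_prod_Ioi, pairSumProd, sq]
  simp only [add_comm]

/-- The product over i < j is not visibly symmetric, but its square times ∏ 2z_i is the full double
product, which is; positivity then permits taking the root. -/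
theorem pairSumProd_comp_perm {z : Fin N → ℝ} (hz : ∀ i, 0 < z i) (σ : Equiv.Perm (Fin N)) :
    pairSumProd (fun i => z (σ i)) = pairSumProd z := by
  have h1 := prod_prod_add_eq (fun i => z (σ i))
  have h2 := prod_prod_add_eq z
  have h3 : ∏ i, ∏ j, (z (σ i) + z (σ j)) = ∏ i, ∏ j, (z i + z j) := by
    rw [← Equiv.prod_comp σ fun i => ∏ j, (z i + z j)]
    exact Finset.prod_congr rfl fun i _ => Equiv.prod_comp σ fun j => z (σ i) + z j
  rw [h3, h2, Equiv.prod_comp σ fun i => 2 * z i] at h1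
  have hpos : (∏ i, 2 * z i) ≠ 0 := (Finset.prod_pos fun i _ => by linarith [hz i]).ne'
  have h4 := mul_left_cancel₀ hpos h1
  exact ((pow_left_inj₀ (pairSumProd_pos hz).le (pairSumProd_pos fun i => hz (σ i)).le
    two_ne_zero).1 h4).symm

theorem vandermondeDet_comp_perm (z : Fin N → ℝ) (σ : Equiv.Perm (Fin N)) :
    vandermondeDet (fun i => z (σ i)) = Equiv.Perm.sign σ * vandermondeDet z := by
  rw [vandermondeDet, vandermondeDet, ← Matrix.det_permute]
  rfl

/-- The entries are 2z_j/(z_i + z_j), so this is the Cauchy determinant with both sets of variables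
equal to z. -/
theorem det_one_sub_schurKernel {z : Fin N → ℝ} (hz : ∀ i, 0 < z i) :
    (Matrix.of fun i j => 1 - schurKernel (z i) (z j)).det = ((schurProd z ^ 2 : ℝ) : ℂ) := by
  have h : (Matrix.of fun i j => 1 - schurKernel (z i) (z j)) =
      Complex.ofRealHom.mapMatrix (Matrix.of fun i j => (2 * z j) *
        (Matrix.of fun i j => (z i + z j)⁻¹) i j) := by
    ext i j
    have := (add_pos (hz i) (hz j)).ne'
    simp only [Matrix.of_apply, schurKernel, RingHom.mapMatrix_apply, Matrix.map_apply,
      Complex.ofRealHom_eq_coe]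
    rw [← Complex.ofReal_one, ← Complex.ofReal_sub]
    congr 1
    field_simp
    ring
  rw [h, ← RingHom.map_det, Matrix.det_mul_row, Complex.ofRealHom_eq_coe]
  congr 1
  have h1 := det_inv_add_mul_prod z z fun i j => (add_pos (hz i) (hz j)).ne'
  rw [prod_prod_add_eq] at h1
  rw [schurProd, div_pow, eq_div_iff (pow_pos (pairSumProd_pos hz) 2).ne', vandermondeDet, sq (Matrix.det _), ← h1]
  ring

theorem pfSum_schurKernel_sq [Subsingleton E] (e : (Fin n × Fin 2) ⊕ E ≃ Fin N) {z : Fin N → ℝ}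
    (hz : ∀ i, 0 < z i) :
    pfSum schurKernel (fun _ => 1) (fun i => z (e i)) ^ 2 =
      (pfSum (stdForm n E ℂ) (stdLin n E ℂ) id * (schurProd z : ℂ)) ^ 2 := by
  rw [pfSum_sq _ schurKernel_antisymm, mul_pow, ← Complex.ofReal_pow,
    ← det_one_sub_schurKernel hz, ← Matrix.det_submatrix_equiv_self e]
  congr 2
  ext i j
  simp

theorem continuousOn_pfSum_schurKernel (e : (Fin n × Fin 2) ⊕ E ≃ Fin N) :
    ContinuousOn (fun z : Fin N → ℝ => pfSum schurKernel (fun _ => 1) (fun i => z (e i)))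
      {z | ∀ i, 0 < z i} := by
  refine continuousOn_finsetSum _ fun σ _ => ?_
  simp only [pfTerm, Units.smul_def, zsmul_eq_mul, Finset.prod_const_one, mul_one]
  refine continuousOn_const.mul (continuousOn_finsetProd _ fun i _ => ?_)
  refine Complex.continuous_ofReal.comp_continuousOn (ContinuousOn.div (by fun_prop) (by fun_prop) ?_)
  intro z hz
  exact (add_pos (hz _) (hz _)).ne'

theorem continuousOn_schurProd :
    ContinuousOn (fun z : Fin N → ℝ => (schurProd z : ℂ)) {z | ∀ i, 0 < z i} := by
  refine Complex.continuous_ofReal.comp_continuousOn (ContinuousOn.div ?_ ?_ ?_)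
  · refine Continuous.continuousOn ?_
    refine Continuous.matrix_det (continuous_matrix fun i j => ?_)
    simp only [Matrix.vandermonde_apply]
    fun_prop
  · refine Continuous.continuousOn ?_
    unfold pairSumProd
    fun_prop
  · intro z hz
    exact (pairSumProd_pos hz).ne'

/-- Schur's Pfaffian, up to normalisation and a global sign. -/
theorem exists_pfSum_schurKernel_eq [Subsingleton E] (e : (Fin n × Fin 2) ⊕ E ≃ Fin N) :
    ∃ c : ℂ, c ^ 2 = pfSum (stdForm n E ℂ) (stdLin n E ℂ) id ^ 2 ∧
      ∀ z : Fin N → ℝ, (∀ i, 0 < z i) →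
        pfSum schurKernel (fun _ => 1) (fun i => z (e i)) = c * (schurProd z : ℂ) := by
  set c₀ := pfSum (stdForm n E ℂ) (stdLin n E ℂ) id with hc₀
  have hc₀ne : c₀ ≠ 0 := pfSum_std_ne_zero
  -- The squares are known to agree, so only a sign is left. On this convex chamber Schur's product
  -- has no zero, hence continuity makes the sign constant; antisymmetry carries it to the other
  -- chambers, and both sides vanish when coordinates coincide.
  set S : Set (Fin N → ℝ) := {z | (∀ i, 0 < z i) ∧ StrictMono z} with hS
  have hconv : Convex ℝ S := by
    rintro x ⟨hx, hx'⟩ y ⟨hy, hy'⟩ s t hs ht hst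
    have hlt : ∀ p q p' q' : ℝ, p < p' → q < q' → s * p + t * q < s * p' + t * q' := by
      intro p q p' q' hp hq
      rcases hs.eq_or_lt with rfl | hs'
      · obtain rfl : t = 1 := by linarith
        linarith
      · have := mul_lt_mul_of_pos_left hp hs'
        have := mul_le_mul_of_nonneg_left hq.le ht
        linarith
    refine ⟨fun i => ?_, fun i j hij => ?_⟩
    · simpa using hlt 0 0 _ _ (hx i) (hy i)
    · simpa using hlt _ _ _ _ (hx' hij) (hy' hij)
  have hsub : S ⊆ {z | ∀ i, 0 < z i} := fun z hz => hz.1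
  have hne : ∀ {z}, z ∈ S → c₀ * (schurProd z : ℂ) ≠ 0 := by
    intro z hz
    refine mul_ne_zero hc₀ne (Complex.ofReal_ne_zero.2 (div_ne_zero ?_ (pairSumProd_pos hz.1).ne'))
    exact Matrix.det_vandermonde_ne_zero_iff.2 hz.2.injective
  have hdich := hconv.isPreconnected.eq_or_eq_neg_of_sq_eq
    ((continuousOn_pfSum_schurKernel e).mono hsub)
    ((continuousOn_const (c := c₀)).mul (continuousOn_schurProd.mono hsub))
    (fun z hz => pfSum_schurKernel_sq e hz.1) hne
  obtain ⟨c, hc, hcS⟩ : ∃ c : ℂ, c ^ 2 = c₀ ^ 2 ∧ ∀ z ∈ S,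
      pfSum schurKernel (fun _ => 1) (fun i => z (e i)) = c * (schurProd z : ℂ) := by
    rcases hdich with h | h
    · exact ⟨c₀, rfl, h⟩
    · refine ⟨-c₀, neg_sq c₀, fun z hz => ?_⟩
      rw [neg_mul]
      exact h hz
  refine ⟨c, hc, fun z hz => ?_⟩
  by_cases hinj : Function.Injective z
  · set σ := Tuple.sort z with hσ
    have hmono : StrictMono (fun i => z (σ i)) :=
      (Tuple.monotone_sort z).strictMono_of_injective (hinj.comp σ.injective)
    have h := hcS (fun i => z (σ i)) ⟨fun i => hz _, hmono⟩
    set τ : Equiv.Perm ((Fin n × Fin 2) ⊕ E) := (e.trans σ).trans e.symm with hτ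
    have hsign : Equiv.Perm.sign τ = Equiv.Perm.sign σ :=
      Equiv.Perm.sign_eq_sign_of_equiv _ _ e (by intro x; simp [hτ])
    have hz' : (fun i => z (σ (e i))) = fun i => (fun i => z (e i)) (τ i) := by
      ext i
      simp [hτ]
    rw [hz', pfSum_comp_perm schurKernel (fun _ => 1) (fun i => z (e i)) τ, hsign, schurProd, vandermondeDet_comp_perm,
      pairSumProd_comp_perm hz, mul_div_assoc, ← schurProd, Units.smul_def, zsmul_eq_mul] at h
    have hs : ((Equiv.Perm.sign σ : ℤ) : ℂ) ≠ 0 := by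
      rw [Int.cast_ne_zero]
      exact (Equiv.Perm.sign σ).ne_zero
    refine mul_left_cancel₀ hs ?_
    rw [h]
    push_cast
    ring
  · have h0 : schurProd z = 0 := by
      rw [schurProd, vandermondeDet, Matrix.det_vandermonde_eq_zero_iff.2, zero_div]
      obtain ⟨i, j, hij, hne⟩ := Function.not_injective_iff.1 hinj
      exact ⟨i, j, hij, hne⟩
    have h := pfSum_schurKernel_sq e hz
    rw [h0] at h
    rw [h0]
    simpa using h

end Schur

/-! ### Integration over products of the half-line -/

section Integrals

variable {ι ι' : Type*} [Fintype ι] [Fintype ι']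

/-- Lebesgue measure on the positive half-line. -/
noncomputable def posMeasure : Measure ℝ := volume.restrict (Set.Ioi 0)

instance : SigmaFinite posMeasure := by
  unfold posMeasure
  infer_instance

theorem pi_posMeasure :
    (Measure.pi fun _ : ι => posMeasure) = volume.restrict (Set.univ.pi fun _ => Set.Ioi 0) := by
  rw [volume_pi, Measure.restrict_pi_pi]
  rfl

theorem ae_pi_posMeasure : ∀ᵐ z ∂(Measure.pi fun _ : ι => posMeasure), ∀ i, 0 < z i := by
  rw [pi_posMeasure]
  filter_upwards [ae_restrict_mem (MeasurableSet.univ_pi fun _ => measurableSet_Ioi)] with z hz i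
  exact hz i trivial

theorem ae_prod_pi_posMeasure :
    ∀ᵐ p ∂((Measure.pi fun _ : ι => posMeasure).prod (Measure.pi fun _ : ι' => posMeasure)),
      (∀ i, 0 < p.1 i) ∧ ∀ i, 0 < p.2 i := by
  filter_upwards [Measure.quasiMeasurePreserving_fst.ae ae_pi_posMeasure,
    Measure.quasiMeasurePreserving_snd.ae ae_pi_posMeasure] with p h1 h2
  exact ⟨h1, h2⟩

theorem ae_prod_posMeasure : ∀ᵐ p ∂(posMeasure.prod posMeasure), 0 < p.1 ∧ 0 < p.2 := by
  have h : ∀ᵐ x ∂posMeasure, 0 < x := ae_restrict_mem measurableSet_Ioi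
  filter_upwards [Measure.quasiMeasurePreserving_fst.ae h,
    Measure.quasiMeasurePreserving_snd.ae h] with p h1 h2
  exact ⟨h1, h2⟩

theorem integral_pi_comp_equiv (μ : Measure ℝ) [SigmaFinite μ] (e : ι ≃ ι') (f : (ι → ℝ) → ℂ) :
    ∫ z, f (fun i => z (e i)) ∂(Measure.pi fun _ : ι' => μ) =
      ∫ z, f z ∂(Measure.pi fun _ : ι => μ) :=
  (measurePreserving_piCongrLeft (α := fun _ : ι' => ℝ) (fun _ => μ) e).symm.integral_comp' f

theorem integral_prod_pair_arrow (μ : Measure ℝ) [SigmaFinite μ] (g : ι → ℝ × ℝ → ℂ) :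
    ∫ p, ∏ i, g i (p.1 i, p.2 i)
      ∂((Measure.pi fun _ : ι => μ).prod (Measure.pi fun _ : ι => μ)) =
      ∏ i, ∫ p, g i p ∂(μ.prod μ) := by
  rw [← integral_fintype_prod_eq_prod]
  exact ((measurePreserving_arrowProdEquivProdArrow ℝ ℝ ι (fun _ => μ)
    (fun _ => μ)).integral_comp' fun p => ∏ i, g i (p.1 i, p.2 i)).symm

theorem integral_sum_arrow (μ : Measure ℝ) [SigmaFinite μ] (f : (ι → ℝ) × (ι' → ℝ) → ℂ) :
    ∫ z, f (fun i => z (Sum.inl i), fun i => z (Sum.inr i)) ∂(Measure.pi fun _ : ι ⊕ ι' => μ) =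
      ∫ p, f p ∂((Measure.pi fun _ : ι => μ).prod (Measure.pi fun _ : ι' => μ)) :=
  (measurePreserving_sumPiEquivProdPi (X := fun _ : ι ⊕ ι' => ℝ) fun _ => μ).integral_comp' f

theorem integral_prod_pair (μ : Measure ℝ) [SigmaFinite μ] {n : ℕ} (g : Fin n → ℝ × ℝ → ℂ) :
    ∫ z, ∏ i, g i (z (i, 0), z (i, 1)) ∂(Measure.pi fun _ : Fin n × Fin 2 => μ) =
      ∏ i, ∫ p, g i p ∂(μ.prod μ) := by
  -- Separates the first members of the pairs from the second ones.
  set q : Fin n ⊕ Fin n ≃ Fin n × Fin 2 :=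
    (((Equiv.prodComm _ _).trans (finTwoEquiv.prodCongr (Equiv.refl _))).trans
      (Equiv.boolProdEquivSum (Fin n))).symm with hq
  rw [← integral_prod_pair_arrow, ← integral_sum_arrow, ← integral_pi_comp_equiv μ q]
  rfl

/-- The bimoment of `φ` and `ψ` with respect to the kernel `k`. -/
noncomputable def bimoment (k : ℝ → ℝ → ℂ) (φ ψ : ℝ → ℂ) : ℂ :=
  ∫ p, k p.1 p.2 * (φ p.1 * ψ p.2) ∂(posMeasure.prod posMeasure)

/-- A measurable kernel bounded by one on the positive quadrant. -/
structure BoundedKernel (k : ℝ → ℝ → ℂ) : Prop where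
  measurable : Measurable (Function.uncurry k)
  norm_le_one : ∀ x y, 0 < x → 0 < y → ‖k x y‖ ≤ 1

theorem BoundedKernel.measurable_comp {k : ℝ → ℝ → ℂ} (hk : BoundedKernel k) {X : Type*}
    [MeasurableSpace X] {f g : X → ℝ} (hf : Measurable f) (hg : Measurable g) :
    Measurable fun x => k (f x) (g x) :=
  hk.measurable.comp (hf.prodMk hg)

theorem BoundedKernel.integrable_mul {k : ℝ → ℝ → ℂ} (hk : BoundedKernel k) {φ ψ : ℝ → ℂ}
    (hφ : Integrable φ posMeasure) (hψ : Integrable ψ posMeasure) :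
    Integrable (fun p : ℝ × ℝ => k p.1 p.2 * (φ p.1 * ψ p.2)) (posMeasure.prod posMeasure) := by
  refine (hφ.mul_prod hψ).bdd_mul (c := 1)
    (hk.measurable_comp measurable_fst measurable_snd).aestronglyMeasurable ?_
  filter_upwards [ae_prod_posMeasure] with p hp
  exact hk.norm_le_one _ _ hp.1 hp.2

theorem BoundedKernel.integrable_prod_mul {k : ℝ → ℝ → ℂ} (hk : BoundedKernel k)
    (σ : Equiv.Perm ι) {f : (ι → ℝ) × (ι → ℝ) → ℂ}
    (hf : Integrable f
      ((Measure.pi fun _ : ι => posMeasure).prod (Measure.pi fun _ : ι => posMeasure))) :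
    Integrable (fun p => (∏ i, k (p.1 (σ i)) (p.2 i)) * f p)
      ((Measure.pi fun _ : ι => posMeasure).prod (Measure.pi fun _ : ι => posMeasure)) := by
  refine hf.bdd_mul (c := 1) (Measurable.aestronglyMeasurable ?_) ?_
  · exact Finset.measurable_fun_prod _ fun i _ => hk.measurable_comp
      ((measurable_pi_apply _).comp measurable_fst) ((measurable_pi_apply _).comp measurable_snd)
  · filter_upwards [ae_prod_pi_posMeasure] with p hp
    rw [norm_prod]
    exact Finset.prod_le_one (fun _ _ => norm_nonneg _) fun i _ =>
      hk.norm_le_one _ _ (hp.1 _) (hp.2 _)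

/-- The determinant `det [φ i (z j)]`. -/
def alternant [DecidableEq ι] (φ : ι → ℝ → ℂ) (z : ι → ℝ) : ℂ :=
  (Matrix.of fun i j => φ i (z j)).det

variable [DecidableEq ι]

theorem alternant_apply (φ : ι → ℝ → ℂ) (z : ι → ℝ) :
    alternant φ z = ∑ σ : Equiv.Perm ι, ((Equiv.Perm.sign σ : ℤ) : ℂ) * ∏ i, φ (σ i) (z i) := by
  simp only [alternant, Matrix.det_apply, Units.smul_def, zsmul_eq_mul, Matrix.of_apply]

theorem alternant_comp_perm (φ : ι → ℝ → ℂ) (z : ι → ℝ) (σ : Equiv.Perm ι) :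
    alternant φ (fun i => z (σ i)) = ((Equiv.Perm.sign σ : ℤ) : ℂ) * alternant φ z :=
  Matrix.det_permute' σ (Matrix.of fun i j => φ i (z j))

theorem integrable_alternant {φ : ι → ℝ → ℂ} (hφ : ∀ i, Integrable (φ i) posMeasure) :
    Integrable (alternant φ) (Measure.pi fun _ : ι => posMeasure) := by
  have : alternant φ = fun z => ∑ σ : Equiv.Perm ι,
      ((Equiv.Perm.sign σ : ℤ) : ℂ) * ∏ i, φ (σ i) (z i) := funext (alternant_apply φ)
  rw [this]
  exact integrable_finsetSum _ fun σ _ =>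
    (Integrable.fintype_prod fun i => hφ (σ i)).const_mul _

/-! ### De Bruijn's integration formula -/

section DeBruijn

variable {n : ℕ} {E : Type*} [Fintype E]

theorem BoundedKernel.integrable_pfTerm_mul {k : ℝ → ℝ → ℂ} (hk : BoundedKernel k)
    (σ : Equiv.Perm ((Fin n × Fin 2) ⊕ E)) {f : ((Fin n × Fin 2) ⊕ E → ℝ) → ℂ}
    (hf : Integrable f (Measure.pi fun _ => posMeasure)) :
    Integrable (fun z => pfTerm k (fun _ => 1) (fun i => z (σ i)) * f z)
      (Measure.pi fun _ => posMeasure) := by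
  simp only [pfTerm, Finset.prod_const_one, mul_one]
  refine hf.bdd_mul (c := 1) (Measurable.aestronglyMeasurable ?_) ?_
  · exact Finset.measurable_fun_prod _ fun i _ =>
      hk.measurable_comp (measurable_pi_apply _) (measurable_pi_apply _)
  · filter_upwards [ae_pi_posMeasure] with z hz
    rw [norm_prod]
    exact Finset.prod_le_one (fun _ _ => norm_nonneg _) fun i _ =>
      hk.norm_le_one _ _ (hz _) (hz _)

theorem integral_pfTerm_mul_prod (k : ℝ → ℝ → ℂ) (φ : (Fin n × Fin 2) ⊕ E → ℝ → ℂ) :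
    ∫ z, pfTerm k (fun _ => 1) z * ∏ j, φ j (z j) ∂(Measure.pi fun _ => posMeasure) =
      pfTerm (fun i j => bimoment k (φ i) (φ j)) (fun i => ∫ x, φ i x ∂posMeasure) id := by
  set F : (Fin n × Fin 2 → ℝ) × (E → ℝ) → ℂ := fun p =>
    (∏ i, (fun q : ℝ × ℝ => k q.1 q.2 * (φ (Sum.inl (i, 0)) q.1 * φ (Sum.inl (i, 1)) q.2))
      (p.1 (i, 0), p.1 (i, 1))) * ∏ e, φ (Sum.inr e) (p.2 e) with hF
  have h1 : ∀ z : (Fin n × Fin 2) ⊕ E → ℝ, pfTerm k (fun _ => 1) z * ∏ j, φ j (z j) =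
      F (fun i => z (Sum.inl i), fun i => z (Sum.inr i)) := by
    intro z
    simp only [hF, pfTerm, Finset.prod_const_one, mul_one, Fintype.prod_sum_type,
      Fintype.prod_prod_type, Fin.prod_univ_two, Finset.prod_mul_distrib]
    ring
  refine (integral_congr_ae (Filter.Eventually.of_forall h1)).trans
    ((integral_sum_arrow posMeasure F).trans ?_)
  rw [integral_prod_mul (fun z : Fin n × Fin 2 → ℝ =>
      ∏ i, (fun q : ℝ × ℝ => k q.1 q.2 * (φ (Sum.inl (i, 0)) q.1 * φ (Sum.inl (i, 1)) q.2))
          (z (i, 0), z (i, 1))) (fun z : E → ℝ => ∏ e, φ (Sum.inr e) (z e))]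
  exact congrArg₂ (· * ·)
    (integral_prod_pair posMeasure fun i (q : ℝ × ℝ) =>
      k q.1 q.2 * (φ (Sum.inl (i, 0)) q.1 * φ (Sum.inl (i, 1)) q.2))
    (integral_fintype_prod_eq_prod fun e => φ (Sum.inr e))

variable [DecidableEq E]

/-- De Bruijn's integration formula, uniformly in the parity of the number of variables. -/
theorem integral_pfSum_mul_alternant {k : ℝ → ℝ → ℂ} (hk : BoundedKernel k)
    {φ : (Fin n × Fin 2) ⊕ E → ℝ → ℂ} (hφ : ∀ i, Integrable (φ i) posMeasure) :
    ∫ z, pfSum k (fun _ => 1) z * alternant φ z ∂(Measure.pi fun _ => posMeasure) =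
      ((Fintype.card ((Fin n × Fin 2) ⊕ E)).factorial : ℂ) *
        pfSum (fun i j => bimoment k (φ i) (φ j)) (fun i => ∫ x, φ i x ∂posMeasure) id := by
  -- The sign of each Pfaffian term is absorbed by the alternant; after relabelling the variables
  -- all terms have the same integral.
  have h1 : ∀ z, pfSum k (fun _ => 1) z * alternant φ z =
      ∑ σ : Equiv.Perm ((Fin n × Fin 2) ⊕ E),
        pfTerm k (fun _ => 1) (fun i => z (σ i)) * alternant φ (fun i => z (σ i)) := by
    intro z
    rw [pfSum, Finset.sum_mul]
    refine Finset.sum_congr rfl fun σ _ => ?_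
    rw [alternant_comp_perm, Units.smul_def, zsmul_eq_mul]
    ring
  have h2 : ∫ z, pfTerm k (fun _ => 1) z * alternant φ z ∂(Measure.pi fun _ => posMeasure) =
      pfSum (fun i j => bimoment k (φ i) (φ j)) (fun i => ∫ x, φ i x ∂posMeasure) id := by
    simp only [alternant_apply, Finset.mul_sum]
    rw [integral_finsetSum, pfSum]
    · refine Finset.sum_congr rfl fun σ _ => ?_
      rw [Units.smul_def, zsmul_eq_mul]
      have h := integral_pfTerm_mul_prod k fun i => φ (σ i)
      change _ = _ * pfTerm (fun i j => bimoment k (φ (σ i)) (φ (σ j)))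
        (fun i => ∫ x, φ (σ i) x ∂posMeasure) id
      rw [← h, ← integral_const_mul]
      refine integral_congr_ae (Filter.Eventually.of_forall fun z => ?_)
      ring
    · intro σ _
      exact hk.integrable_pfTerm_mul 1
        ((Integrable.fintype_prod fun i => hφ (σ i)).const_mul _)
  rw [integral_congr_ae (Filter.Eventually.of_forall h1), integral_finsetSum]
  · have h3 : ∀ σ : Equiv.Perm ((Fin n × Fin 2) ⊕ E),
        ∫ z, pfTerm k (fun _ => 1) (fun i => z (σ i)) * alternant φ (fun i => z (σ i))
          ∂(Measure.pi fun _ => posMeasure) =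
        pfSum (fun i j => bimoment k (φ i) (φ j)) (fun i => ∫ x, φ i x ∂posMeasure) id := by
      intro σ
      rw [integral_pi_comp_equiv posMeasure σ fun z => pfTerm k (fun _ => 1) z * alternant φ z, h2]
    rw [Finset.sum_congr rfl fun σ _ => h3 σ, Finset.sum_const, Finset.card_univ,
      Fintype.card_perm, nsmul_eq_mul]
  · intro σ _
    refine hk.integrable_pfTerm_mul σ ?_
    simp only [alternant_comp_perm]
    exact (integrable_alternant hφ).const_mul _

end DeBruijn

/-! ### Andréief's identity for two sets of variables -/

section Andreief

/-- The determinant `det [k (x i) (y j)]`. -/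
def kernelDet (k : ℝ → ℝ → ℂ) (p : (ι → ℝ) × (ι → ℝ)) : ℂ :=
  (Matrix.of fun i j => k (p.1 i) (p.2 j)).det

theorem kernelDet_apply (k : ℝ → ℝ → ℂ) (p : (ι → ℝ) × (ι → ℝ)) :
    kernelDet k p = ∑ σ : Equiv.Perm ι,
      ((Equiv.Perm.sign σ : ℤ) : ℂ) * ∏ i, k (p.1 (σ i)) (p.2 i) := by
  simp only [kernelDet, Matrix.det_apply, Units.smul_def, zsmul_eq_mul, Matrix.of_apply]

theorem BoundedKernel.integrable_kernelDet_mul {k : ℝ → ℝ → ℂ} (hk : BoundedKernel k)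
    {f : (ι → ℝ) × (ι → ℝ) → ℂ}
    (hf : Integrable f
      ((Measure.pi fun _ : ι => posMeasure).prod (Measure.pi fun _ : ι => posMeasure))) :
    Integrable (fun p => kernelDet k p * f p)
      ((Measure.pi fun _ : ι => posMeasure).prod (Measure.pi fun _ : ι => posMeasure)) := by
  simp only [kernelDet_apply, Finset.sum_mul, mul_assoc]
  exact integrable_finsetSum _ fun σ _ => (hk.integrable_prod_mul σ hf).const_mul _

/-- Expanding both alternants factorises the integral into bimoments; for each fixed τ the sum over
σ is det G, its column permutation being undone by sign τ. -/
theorem integral_prod_kernel_mul_alternant_mul_alternant {k : ℝ → ℝ → ℂ} (hk : BoundedKernel k)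
    {φ : ι → ℝ → ℂ} (hφ : ∀ i, Integrable (φ i) posMeasure) :
    ∫ p, (∏ i, k (p.1 i) (p.2 i)) * (alternant φ p.1 * alternant φ p.2)
      ∂((Measure.pi fun _ : ι => posMeasure).prod (Measure.pi fun _ : ι => posMeasure)) =
      ((Fintype.card ι).factorial : ℂ) *
        (Matrix.of fun i j => bimoment k (φ i) (φ j)).det := by
  set G : Matrix ι ι ℂ := Matrix.of fun i j => bimoment k (φ i) (φ j) with hG
  have hint : ∀ σ τ : Equiv.Perm ι, Integrable (fun p : (ι → ℝ) × (ι → ℝ) =>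
      (∏ i, k (p.1 i) (p.2 i)) * ((∏ i, φ (σ i) (p.1 i)) * ∏ i, φ (τ i) (p.2 i)))
      ((Measure.pi fun _ : ι => posMeasure).prod (Measure.pi fun _ : ι => posMeasure)) :=
    fun σ τ => hk.integrable_prod_mul 1 (Integrable.mul_prod
      (Integrable.fintype_prod fun i => hφ (σ i)) (Integrable.fintype_prod fun i => hφ (τ i)))
  have hval : ∀ σ τ : Equiv.Perm ι, ∫ p : (ι → ℝ) × (ι → ℝ),
      (∏ i, k (p.1 i) (p.2 i)) * ((∏ i, φ (σ i) (p.1 i)) * ∏ i, φ (τ i) (p.2 i))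
      ∂((Measure.pi fun _ : ι => posMeasure).prod (Measure.pi fun _ : ι => posMeasure)) =
      ∏ i, G (σ i) (τ i) := by
    intro σ τ
    have h := integral_prod_pair_arrow posMeasure
      fun (i : ι) (q : ℝ × ℝ) => k q.1 q.2 * (φ (σ i) q.1 * φ (τ i) q.2)
    simp only [Finset.prod_mul_distrib] at h
    exact h
  have hexp : ∀ p : (ι → ℝ) × (ι → ℝ),
      (∏ i, k (p.1 i) (p.2 i)) * (alternant φ p.1 * alternant φ p.2) =
      ∑ τ : Equiv.Perm ι, ∑ σ : Equiv.Perm ι,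
        (((Equiv.Perm.sign τ : ℤ) : ℂ) * ((Equiv.Perm.sign σ : ℤ) : ℂ)) *
        ((∏ i, k (p.1 i) (p.2 i)) * ((∏ i, φ (σ i) (p.1 i)) * ∏ i, φ (τ i) (p.2 i))) := by
    intro p
    rw [alternant_apply, alternant_apply, Finset.sum_mul_sum, Finset.sum_comm, Finset.mul_sum]
    refine Finset.sum_congr rfl fun τ _ => ?_
    rw [Finset.mul_sum]
    refine Finset.sum_congr rfl fun σ _ => ?_
    ring
  rw [integral_congr_ae (Filter.Eventually.of_forall hexp), integral_finsetSum _ fun τ _ =>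
    integrable_finsetSum _ fun σ _ => (hint σ τ).const_mul _]
  have hτ : ∀ τ : Equiv.Perm ι, ∫ p : (ι → ℝ) × (ι → ℝ), ∑ σ : Equiv.Perm ι,
        (((Equiv.Perm.sign τ : ℤ) : ℂ) * ((Equiv.Perm.sign σ : ℤ) : ℂ)) *
        ((∏ i, k (p.1 i) (p.2 i)) * ((∏ i, φ (σ i) (p.1 i)) * ∏ i, φ (τ i) (p.2 i)))
      ∂((Measure.pi fun _ : ι => posMeasure).prod (Measure.pi fun _ : ι => posMeasure)) =
      G.det := by
    intro τ
    rw [integral_finsetSum _ fun σ _ => (hint σ τ).const_mul _]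
    have h := Matrix.det_permute' τ G
    rw [Matrix.det_apply] at h
    simp only [integral_const_mul, hval, mul_assoc]
    rw [← Finset.mul_sum]
    have h' : ∑ σ : Equiv.Perm ι, ((Equiv.Perm.sign σ : ℤ) : ℂ) * ∏ i, G (σ i) (τ i) =
        ((Equiv.Perm.sign τ : ℤ) : ℂ) * G.det := by
      rw [← h]
      refine Finset.sum_congr rfl fun σ _ => ?_
      rw [Units.smul_def, zsmul_eq_mul]
      rfl
    rw [h', ← mul_assoc, ← Int.cast_mul, ← Units.val_mul, Int.units_mul_self]
    simp
  rw [Finset.sum_congr rfl fun τ _ => hτ τ, Finset.sum_const, Finset.card_univ,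
    Fintype.card_perm, nsmul_eq_mul]

/-- Andréief's identity for a two-matrix ensemble. -/
theorem integral_kernelDet_mul_alternant_mul_alternant {k : ℝ → ℝ → ℂ} (hk : BoundedKernel k)
    {φ : ι → ℝ → ℂ} (hφ : ∀ i, Integrable (φ i) posMeasure) :
    ∫ p, kernelDet k p * (alternant φ p.1 * alternant φ p.2)
      ∂((Measure.pi fun _ : ι => posMeasure).prod (Measure.pi fun _ : ι => posMeasure)) =
      ((Fintype.card ι).factorial : ℂ) ^ 2 *
        (Matrix.of fun i j => bimoment k (φ i) (φ j)).det := by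
  have hint := (integrable_alternant hφ).mul_prod (integrable_alternant hφ)
  have hexp : ∀ p : (ι → ℝ) × (ι → ℝ), kernelDet k p * (alternant φ p.1 * alternant φ p.2) =
      ∑ σ : Equiv.Perm ι, (∏ i, k (p.1 (σ i)) (p.2 i)) *
        (alternant φ (fun i => p.1 (σ i)) * alternant φ p.2) := by
    intro p
    rw [kernelDet_apply, Finset.sum_mul]
    refine Finset.sum_congr rfl fun σ _ => ?_
    rw [alternant_comp_perm]
    ring
  rw [integral_congr_ae (Filter.Eventually.of_forall hexp), integral_finsetSum]
  · have hσ : ∀ σ : Equiv.Perm ι, ∫ p : (ι → ℝ) × (ι → ℝ), (∏ i, k (p.1 (σ i)) (p.2 i)) *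
        (alternant φ (fun i => p.1 (σ i)) * alternant φ p.2)
        ∂((Measure.pi fun _ : ι => posMeasure).prod (Measure.pi fun _ : ι => posMeasure)) =
        ((Fintype.card ι).factorial : ℂ) *
          (Matrix.of fun i j => bimoment k (φ i) (φ j)).det := by
      intro σ
      rw [← integral_prod_kernel_mul_alternant_mul_alternant hk hφ]
      have h1 := (measurePreserving_piCongrLeft (α := fun _ : ι => ℝ)
        (fun _ => posMeasure) σ).symm
      have h2 := h1.prod (MeasurePreserving.id (Measure.pi fun _ : ι => posMeasure))
      exact h2.integral_comp (MeasurableEquiv.prodCongr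
        (MeasurableEquiv.piCongrLeft (fun _ : ι => ℝ) σ).symm
        (MeasurableEquiv.refl _)).measurableEmbedding
        fun p => (∏ i, k (p.1 i) (p.2 i)) * (alternant φ p.1 * alternant φ p.2)
    rw [Finset.sum_congr rfl fun σ _ => hσ σ, Finset.sum_const, Finset.card_univ,
      Fintype.card_perm, nsmul_eq_mul]
    ring
  · intro σ _
    refine hk.integrable_prod_mul σ ?_
    simp only [alternant_comp_perm, mul_assoc]
    exact hint.const_mul _

end Andreief

end Integrals

/-! ### The Bures-like and Cauchy-like ensembles -/

section Ensembles

variable {N k l : ℕ}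

theorem boundedKernel_schurKernel : BoundedKernel schurKernel where
  measurable := by
    unfold schurKernel Function.uncurry
    fun_prop
  norm_le_one x y hx hy := by
    rw [schurKernel, Complex.norm_real, Real.norm_eq_abs, abs_div, abs_of_pos (add_pos hx hy),
      div_le_one (add_pos hx hy), abs_le]
    constructor <;> linarith

theorem bimoment_schurKernel_antisymm (φ ψ : ℝ → ℂ) :
    bimoment schurKernel φ ψ = - bimoment schurKernel ψ φ := by
  rw [bimoment, bimoment, ← integral_prod_swap, ← integral_neg]
  refine integral_congr_ae (Filter.Eventually.of_forall fun p => ?_)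
  simp only [Prod.fst_swap, Prod.snd_swap]
  rw [schurKernel_antisymm]
  ring

/-- The kernel `y / (x + y)` of the Cauchy-like two-matrix ensemble. -/
noncomputable def cauchyKernel (x y : ℝ) : ℂ := ((y / (x + y) : ℝ) : ℂ)

theorem boundedKernel_cauchyKernel : BoundedKernel cauchyKernel where
  measurable := by
    unfold cauchyKernel Function.uncurry
    fun_prop
  norm_le_one x y hx hy := by
    rw [cauchyKernel, Complex.norm_real, Real.norm_eq_abs, abs_div, abs_of_pos (add_pos hx hy),
      div_le_one (add_pos hx hy), abs_of_pos hy]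
    linarith

theorem moment_mul_moment_sub_bimoment {φ ψ : ℝ → ℂ} (hφ : Integrable φ posMeasure)
    (hψ : Integrable ψ posMeasure) :
    (∫ x, φ x ∂posMeasure) * (∫ x, ψ x ∂posMeasure) - bimoment schurKernel φ ψ =
      2 * bimoment cauchyKernel φ ψ := by
  rw [bimoment, bimoment, ← integral_prod_mul, ← integral_const_mul, ← integral_sub
    (hφ.mul_prod hψ) (boundedKernel_schurKernel.integrable_mul hφ hψ)]
  refine integral_congr_ae ?_
  filter_upwards [ae_prod_posMeasure] with p hp
  have h : (1 : ℂ) - schurKernel p.1 p.2 = 2 * cauchyKernel p.1 p.2 := by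
    have h0 : p.1 + p.2 ≠ 0 := (add_pos hp.1 hp.2).ne'
    rw [schurKernel, cauchyKernel]
    norm_cast
    field_simp
    ring
  linear_combination (φ p.1 * ψ p.2) * h

/-- The one-point functions `z ^ j * w z`. -/
def momentFun (N : ℕ) (w : ℝ → ℂ) (j : Fin N) (z : ℝ) : ℂ := (z : ℂ) ^ (j : ℕ) * w z

theorem alternant_momentFun (w : ℝ → ℂ) (z : Fin N → ℝ) :
    alternant (momentFun N w) z = (vandermondeDet z : ℂ) * ∏ j, w (z j) := by
  have h : (Matrix.of fun i j => momentFun N w i (z j)) =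
      Matrix.of fun i j => w (z j) *
        (Complex.ofRealHom.mapMatrix (Matrix.vandermonde z)).transpose i j := by
    ext i j
    simp [momentFun, Matrix.vandermonde_apply, mul_comm]
  rw [alternant, h, Matrix.det_mul_row, Matrix.det_transpose, ← RingHom.map_det, mul_comm]
  rfl

theorem positiveOrthant_eq_pi : positiveOrthant N = Set.univ.pi fun _ => Set.Ioi 0 := by
  ext z
  simp [positiveOrthant]

theorem volume_restrict_positiveOrthant :
    (volume.restrict (positiveOrthant N)) = Measure.pi fun _ : Fin N => posMeasure := by
  rw [pi_posMeasure, positiveOrthant_eq_pi]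

theorem volume_restrict_positiveOrthant_prod :
    (volume.restrict (positiveOrthant N ×ˢ positiveOrthant N)) =
      (Measure.pi fun _ : Fin N => posMeasure).prod (Measure.pi fun _ : Fin N => posMeasure) := by
  rw [Measure.volume_eq_prod, ← Measure.prod_restrict, volume_restrict_positiveOrthant]

theorem buresIntegrand_eq (α : ℝ → ℂ) (κ : Fin k → ℂ) (lam : Fin l → ℂ) (z : Fin N → ℝ) :
    buresIntegrand α κ lam z =
      (schurProd z : ℂ) * alternant (momentFun N fun t => α t * charRatio κ lam t) z := by
  rw [alternant_momentFun, buresIntegrand, ← mul_assoc, ← Complex.ofReal_mul, schurProd]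
  congr 2
  rw [pairSumProd]
  ring

theorem kernelDet_cauchyKernel {p : (Fin N → ℝ) × (Fin N → ℝ)} (h1 : ∀ i, 0 < p.1 i)
    (h2 : ∀ i, 0 < p.2 i) :
    kernelDet cauchyKernel p = (((∏ j, p.2 j) * (vandermondeDet p.1 * vandermondeDet p.2 /
      ∏ i, ∏ j, (p.1 i + p.2 j)) : ℝ) : ℂ) := by
  have h : (Matrix.of fun i j => cauchyKernel (p.1 i) (p.2 j)) =
      Complex.ofRealHom.mapMatrix (Matrix.of fun i j => p.2 j *
        (Matrix.of fun i j => (p.1 i + p.2 j)⁻¹) i j) := by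
    ext i j
    simp [cauchyKernel, div_eq_mul_inv]
  have hne : ∏ i, ∏ j, (p.1 i + p.2 j) ≠ 0 := Finset.prod_ne_zero_iff.2 fun i _ =>
    Finset.prod_ne_zero_iff.2 fun j _ => (add_pos (h1 i) (h2 j)).ne'
  rw [kernelDet, h, ← RingHom.map_det, Matrix.det_mul_row, Complex.ofRealHom_eq_coe]
  congr 2
  rw [eq_div_iff hne]
  exact det_inv_add_mul_prod p.1 p.2 fun i j => (add_pos (h1 i) (h2 j)).ne'

theorem cauchyIntegrand_eq (α : ℝ → ℂ) (κ : Fin k → ℂ) (lam : Fin l → ℂ)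
    {p : (Fin N → ℝ) × (Fin N → ℝ)} (h1 : ∀ i, 0 < p.1 i) (h2 : ∀ i, 0 < p.2 i) :
    cauchyIntegrand α κ lam κ lam p = kernelDet cauchyKernel p *
      (alternant (momentFun N fun t => α t * charRatio κ lam t) p.1 *
        alternant (momentFun N fun t => α t * charRatio κ lam t) p.2) := by
  rw [kernelDet_cauchyKernel h1 h2, alternant_momentFun, alternant_momentFun, cauchyIntegrand]
  simp only [Finset.prod_mul_distrib]
  push_cast
  ring

/-- The `N % 2` leftover indices carry the border, so even and odd N are treated together. -/
theorem exists_pairIndex_equiv (N : ℕ) :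
    ∃ n : ℕ, Nonempty ((Fin n × Fin 2) ⊕ Fin (N % 2) ≃ Fin N) := by
  refine ⟨N / 2, ⟨Fintype.equivOfCardEq ?_⟩⟩
  simp only [Fintype.card_sum, Fintype.card_prod, Fintype.card_fin]
  omega

theorem alternant_comp_equiv {ι ι' : Type*} [Fintype ι] [Fintype ι'] [DecidableEq ι]
    [DecidableEq ι'] (e : ι ≃ ι') (φ : ι' → ℝ → ℂ) (z : ι' → ℝ) :
    alternant (fun i => φ (e i)) (fun i => z (e i)) = alternant φ z :=
  Matrix.det_submatrix_equiv_self e (Matrix.of fun i j => φ i (z j))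

/-- The square of a Bures-like integral is a determinant of bimoments. -/
theorem schurProd_mul_alternant {φ : Fin N → ℝ → ℂ} (hφ : ∀ i, Integrable (φ i) posMeasure) :
    Integrable (fun z => (schurProd z : ℂ) * alternant φ z)
      (Measure.pi fun _ : Fin N => posMeasure) ∧
    (∫ z, (schurProd z : ℂ) * alternant φ z ∂(Measure.pi fun _ : Fin N => posMeasure)) ^ 2 =
      (N.factorial : ℂ) ^ 2 *
        (2 ^ N * (Matrix.of fun i j => bimoment cauchyKernel (φ i) (φ j)).det) := by
  obtain ⟨n, ⟨e⟩⟩ := exists_pairIndex_equiv N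
  have hsub : Subsingleton (Fin (N % 2)) :=
    Fin.subsingleton_iff_le_one.2 (Nat.lt_succ_iff.1 (Nat.mod_lt _ two_pos))
  obtain ⟨c, hc, hpf⟩ := exists_pfSum_schurKernel_eq e
  have hc0 : c ≠ 0 := by
    intro h
    rw [h, zero_pow two_ne_zero] at hc
    exact pow_ne_zero 2 pfSum_std_ne_zero hc.symm
  have hφe : ∀ i, Integrable (φ (e i)) posMeasure := fun i => hφ (e i)
  set F : ((Fin n × Fin 2) ⊕ Fin (N % 2) → ℝ) → ℂ := fun z =>
    pfSum schurKernel (fun _ => 1) z * alternant (fun i => φ (e i)) z with hF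
  have hFint : Integrable F (Measure.pi fun _ => posMeasure) := by
    simp only [hF, pfSum, Finset.sum_mul, smul_mul_assoc]
    exact integrable_finsetSum _ fun σ _ => (boundedKernel_schurKernel.integrable_pfTerm_mul σ
      (integrable_alternant hφe)).smul (Equiv.Perm.sign σ : ℤ)
  have hae : (fun z : Fin N → ℝ => F fun i => z (e i)) =ᵐ[Measure.pi fun _ => posMeasure]
      fun z => c * ((schurProd z : ℂ) * alternant φ z) := by
    filter_upwards [ae_pi_posMeasure] with z hz
    simp only [hF]
    rw [hpf z hz, alternant_comp_equiv, mul_assoc]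
  have hmp := (measurePreserving_piCongrLeft (α := fun _ : Fin N => ℝ)
    (fun _ => posMeasure) e).symm
  have hint : Integrable (fun z : Fin N → ℝ => F fun i => z (e i))
      (Measure.pi fun _ => posMeasure) :=
    (hmp.integrable_comp_emb (MeasurableEquiv.measurableEmbedding _)).2 hFint
  refine ⟨?_, ?_⟩
  · have h := (hint.congr hae).const_mul c⁻¹
    simpa [inv_mul_cancel_left₀ hc0] using h
  · have h1 := integral_pfSum_mul_alternant boundedKernel_schurKernel hφe
    rw [← integral_pi_comp_equiv posMeasure e F, integral_congr_ae hae, integral_const_mul,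
      Fintype.card_congr e, Fintype.card_fin] at h1
    have h2 := congrArg (· ^ 2) h1
    simp only [mul_pow] at h2
    -- The square formula for the bimoments has the same constant as Schur's Pfaffian, namely c², so
    -- it cancels.
    rw [pfSum_sq _ ?_, ← hc, mul_left_comm] at h2
    · rw [mul_left_cancel₀ (pow_ne_zero 2 hc0) h2]
      congr 1
      simp only [id, moment_mul_moment_sub_bimoment (hφe _) (hφe _)]
      have h3 := Matrix.det_submatrix_equiv_self e
        ((2 : ℂ) • Matrix.of fun i j => bimoment cauchyKernel (φ i) (φ j))
      rw [Matrix.det_smul, Fintype.card_fin] at h3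
      rw [← h3]
      rfl
    · intro i j
      exact bimoment_schurKernel_antisymm _ _

end Ensembles

theorem mainTheorem1 (N k l : ℕ) (α : ℝ → ℂ) (κ : Fin k → ℂ) (lam : Fin l → ℂ)
    (hκ : ∀ i, ∀ t : ℝ, 0 ≤ t → κ i ≠ (t : ℂ))
    (hκ_inj : Function.Injective κ) (hlam_inj : Function.Injective lam)
    (hα : SuitableWeight N α κ lam) :
    IntegrableOn (fun z : Fin N → ℝ => buresIntegrand α κ lam z) (positiveOrthant N) ∧
    IntegrableOn (fun p : (Fin N → ℝ) × (Fin N → ℝ) => cauchyIntegrand α κ lam κ lam p)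
      (positiveOrthant N ×ˢ positiveOrthant N) ∧
    buresPartition N α κ lam ^ 2 = 2 ^ N * cauchyPartition N α κ lam κ lam := by
  have hφ : ∀ i, Integrable (momentFun N (fun t => α t * charRatio κ lam t) i) posMeasure :=
    fun i => hα i i.2
  obtain ⟨hB, hBsq⟩ := schurProd_mul_alternant hφ
  have hae : (fun p : (Fin N → ℝ) × (Fin N → ℝ) => cauchyIntegrand α κ lam κ lam p)
      =ᵐ[(Measure.pi fun _ : Fin N => posMeasure).prod (Measure.pi fun _ : Fin N => posMeasure)]
      fun p => kernelDet cauchyKernel p *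
      (alternant (momentFun N fun t => α t * charRatio κ lam t) p.1 *
        alternant (momentFun N fun t => α t * charRatio κ lam t) p.2) := by
    filter_upwards [ae_prod_pi_posMeasure] with p hp
    exact cauchyIntegrand_eq α κ lam hp.1 hp.2
  have hfac : (N.factorial : ℂ) ≠ 0 := Nat.cast_ne_zero.2 N.factorial_ne_zero
  refine ⟨?_, ?_, ?_⟩
  · rw [IntegrableOn, volume_restrict_positiveOrthant]
    simpa only [buresIntegrand_eq] using hB
  · rw [IntegrableOn, volume_restrict_positiveOrthant_prod]
    exact (boundedKernel_cauchyKernel.integrable_kernelDet_mul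
      ((integrable_alternant hφ).mul_prod (integrable_alternant hφ))).congr hae.symm
  · rw [buresPartition, cauchyPartition, volume_restrict_positiveOrthant,
      volume_restrict_positiveOrthant_prod, integral_congr_ae hae,
      integral_kernelDet_mul_alternant_mul_alternant boundedKernel_cauchyKernel hφ, mul_pow]
    simp only [buresIntegrand_eq]
    rw [hBsq, Fintype.card_fin]
    field_simp
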